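/- All matroids are finite. A matroid is connected if every two distinct elements of its ground set lie in a common circuit (so a matroid with at most one element is connected). Theorem. Let $M$ be a connected matroid. The following are equivalent. (i) $M$ has the symmetric strong circuit elimination property: whenever $C_1$ and $C_2$ are circuits of $M$ and $e_1\in C_1-C_2$, $e_2\in C_2-C_1$ and $e\in C_1\cap C_2$, there is a circuit $C_3$ of $M$ with $\{e_1,e_2\}\subseteq C_3\subseteq (C_1\cup C_2)-\{e\}$. (ii) $M$ has no pair of skew circuits, that is, there are no distinct circuits $C_1$ and $C_2$ of $M$ with $r(C_1)+r(C_2)=r(C_1\cup C_2)$. (iii) For all integers $k,l>2$, $M$ has no series minor isomorphic to the series connection $S(U_{k-2,k},U_{l-2,l})$. (iv) The dual $M^*$ is unbreakable, that is, $M^*$ is connected and $M^*/F$ is connected for every flat $F$ of $M^*$. Here $U_{r,n}$ is the uniform matroid of rank $r$ on $n$ elements. A series minor of $M$ is a matroid obtained from $M$ by a (possibly empty) sequence of single-element deletions and series contractions, where a series contraction is the contraction of an element that lies in a two-element cocircuit of the current matroid. For matroids $M_1$ and $M_2$ whose ground sets meet in exactly one element $p$, the basepoint, the series connection $S(M_1,M_2)$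 is the matroid on $E(M_1)\cup E(M_2)$ whose circuits are the circuits of $M_1$ avoiding $p$, the circuits of $M_2$ avoiding $p$, and the sets $C_1\cup C_2$ where each $C_i$ is a circuit of $M_i$ containing $p$. Up to isomorphism, $S(U_{k-2,k},U_{l-2,l})$ does not depend on the choice of basepoints. -/

import Mathlib

namespace Matroid

open Set

/-- A matroid is connected if any two distinct elements lie in a common circuit. In particular
a matroid with at most one element is connected. -/
def IsConnected {α : Type*} (M : Matroid α) : Prop :=
  ∀ ⦃e f : α⦄, e ∈ M.E → f ∈ M.E → e ≠ f → ∃ C, M.IsCircuit C ∧ e ∈ C ∧ f ∈ C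

/-- The symmetric strong circuit elimination property. -/
def HasSSCE {α : Type*} (M : Matroid α) : Prop :=
  ∀ ⦃C₁ C₂ : Set α⦄ ⦃e₁ e₂ e : α⦄, M.IsCircuit C₁ → M.IsCircuit C₂ →
    e₁ ∈ C₁ \ C₂ → e₂ ∈ C₂ \ C₁ → e ∈ C₁ ∩ C₂ →
    ∃ C₃, M.IsCircuit C₃ ∧ {e₁, e₂} ⊆ C₃ ∧ C₃ ⊆ (C₁ ∪ C₂) \ {e}

/-- Two sets of elements are skew if `r(X) + r(Y) = r(X ∪ Y)`. -/
def IsSkew {α : Type*} (M : Matroid α) (X Y : Set α) : Prop :=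
  M.eRk X + M.eRk Y = M.eRk (X ∪ Y)

/-- `M` has a pair of (distinct) circuits that are skew. -/
def HasSkewCircuits {α : Type*} (M : Matroid α) : Prop :=
  ∃ C₁ C₂ : Set α, C₁ ≠ C₂ ∧ M.IsCircuit C₁ ∧ M.IsCircuit C₂ ∧ M.IsSkew C₁ C₂

/-- `M` is unbreakable if it is connected and all its contractions by flats are connected. -/
def IsUnbreakable {α : Type*} (M : Matroid α) : Prop :=
  M.IsConnected ∧ ∀ F, M.IsFlat F → (M.contract F).IsConnected

/-- `IsSeriesMinor M N`: the matroid `N` is a series minor of `M`, that is, `N` is obtained from `M`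
by a (possibly empty) sequence of single-element deletions and series contractions, the latter being
contractions of an element of a two-element cocircuit. -/
inductive IsSeriesMinor {α : Type*} (M : Matroid α) : Matroid α → Prop
  | refl : IsSeriesMinor M M
  | delete {N : Matroid α} (e : α) : IsSeriesMinor M N → IsSeriesMinor M (N.delete {e})
  | seriesContract {N : Matroid α} (e f : α) (hef : e ≠ f) (h : N.IsCocircuit {e, f}) :
      IsSeriesMinor M N → IsSeriesMinor M (N.contract {e})

/-- Two matroids are isomorphic if there is a bijection between their ground sets that preserves
independence in both directions. -/
def IsIsomorphic {α β : Type*} (M : Matroid α) (N : Matroid β) : Prop :=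
  ∃ φ : M.E ≃ N.E, ∀ I : Set M.E,
    M.Indep (Subtype.val '' I) ↔ N.Indep (Subtype.val '' (φ '' I))

/-- The uniform matroid `U_{r,n}` on the `n`-element set `Fin n`. -/
def unif (r n : ℕ) : Matroid (Fin n) :=
  (IndepMatroid.ofFinite (E := univ) finite_univ (fun I ↦ I.ncard ≤ r) (by simp)
    (fun _ J hJ hIJ ↦ (ncard_le_ncard hIJ J.toFinite).trans hJ)
    (by
      intro I J _ hJ hlt
      obtain ⟨e, heJ, heI⟩ := exists_mem_notMem_of_ncard_lt_ncard hlt I.toFinite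
      refine ⟨e, heJ, heI, ?_⟩
      rw [ncard_insert_of_notMem heI I.toFinite]
      omega)
    (fun _ _ ↦ subset_univ _)).matroid

@[simp] theorem unif_ground (r n : ℕ) : (unif r n).E = univ := rfl

@[simp] theorem unif_indep_iff {r n : ℕ} {I : Set (Fin n)} :
    (unif r n).Indep I ↔ I.ncard ≤ r := Iff.rfl

section SeriesConnection

variable {α β : Type*}

/-- The elements of `I` that come from the first matroid, without the basepoint. -/
def leftPart (I : Set (Option (α ⊕ β))) : Set α := {x | some (Sum.inl x) ∈ I}

/-- The elements of `I` that come from the second matroid, without the basepoint. -/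
def rightPart (I : Set (Option (α ⊕ β))) : Set β := {x | some (Sum.inr x) ∈ I}

/-- Independence in the series connection; `none` is the common basepoint. -/
def SeriesIndep (M₁ : Matroid α) (p₁ : α) (M₂ : Matroid β) (p₂ : β)
    (I : Set (Option (α ⊕ β))) : Prop :=
  (M₁.Indep (leftPart I) ∧ p₁ ∉ leftPart I) ∧ (M₂.Indep (rightPart I) ∧ p₂ ∉ rightPart I) ∧
    (none ∈ I → M₁.Indep (insert p₁ (leftPart I)) ∨ M₂.Indep (insert p₂ (rightPart I)))

theorem ncard_parts (I : Set (Option (α ⊕ β))) (hI : I.Finite) :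
    (leftPart I).Finite ∧ (rightPart I).Finite ∧
      (none ∉ I → I.ncard = (leftPart I).ncard + (rightPart I).ncard) ∧
      (none ∈ I → I.ncard = (leftPart I).ncard + (rightPart I).ncard + 1) := by
  have hl : Function.Injective (fun x : α ↦ (some (Sum.inl x) : Option (α ⊕ β))) := by
    intro x y h; simpa using h
  have hr : Function.Injective (fun x : β ↦ (some (Sum.inr x) : Option (α ⊕ β))) := by
    intro x y h; simpa using h
  have hL : (leftPart I).Finite := hI.preimage hl.injOn
  have hR : (rightPart I).Finite := hI.preimage hr.injOn
  have hd : Disjoint ((fun x : α ↦ (some (Sum.inl x) : Option (α ⊕ β))) '' leftPart I)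
      ((fun x : β ↦ (some (Sum.inr x) : Option (α ⊕ β))) '' rightPart I) := by
    rw [disjoint_left]
    rintro _ ⟨x, _, rfl⟩ ⟨y, _, h⟩
    simp at h
  have hc := ncard_union_eq hd (hL.image _) (hR.image _)
  rw [ncard_image_of_injective _ hl, ncard_image_of_injective _ hr] at hc
  refine ⟨hL, hR, fun hn ↦ ?_, fun hn ↦ ?_⟩
  · rw [← hc]
    congr 1
    ext (_ | x | x) <;> simp [leftPart, rightPart, hn]
  · rw [← hc, ← ncard_insert_of_notMem (a := none) (by simp) ((hL.image _).union (hR.image _))]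
    congr 1
    ext (_ | x | x) <;> simp [leftPart, rightPart, hn]

theorem Indep.exists_augment {M : Matroid α} {I J : Set α} (hI : M.Indep I) (hJ : M.Indep J)
    (hIf : I.Finite) (hJf : J.Finite) (h : I.ncard < J.ncard) :
    ∃ e ∈ J, e ∉ I ∧ M.Indep (insert e I) := by
  have h' : I.encard < J.encard := by
    rw [← hIf.cast_ncard_eq, ← hJf.cast_ncard_eq]; exact_mod_cast h
  obtain ⟨e, he, hi⟩ := hI.augment hJ h'
  exact ⟨e, he.1, he.2, hi⟩

@[simp] theorem leftPart_insert_inl (x : α) (I : Set (Option (α ⊕ β))) :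
    leftPart (insert (some (Sum.inl x)) I) = insert x (leftPart I) := by
  ext; simp [leftPart]

@[simp] theorem leftPart_insert_inr (x : β) (I : Set (Option (α ⊕ β))) :
    leftPart (insert (some (Sum.inr x)) I) = leftPart I := by
  ext; simp [leftPart]

@[simp] theorem leftPart_insert_none (I : Set (Option (α ⊕ β))) :
    leftPart (insert none I) = leftPart I := by
  ext; simp [leftPart]

@[simp] theorem rightPart_insert_inr (x : β) (I : Set (Option (α ⊕ β))) :
    rightPart (insert (some (Sum.inr x)) I) = insert x (rightPart I) := by
  ext; simp [rightPart]

@[simp] theorem rightPart_insert_inl (x : α) (I : Set (Option (α ⊕ β))) :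
    rightPart (insert (some (Sum.inl x)) I) = rightPart I := by
  ext; simp [rightPart]

@[simp] theorem rightPart_insert_none (I : Set (Option (α ⊕ β))) :
    rightPart (insert none I) = rightPart I := by
  ext; simp [rightPart]

theorem SeriesIndep.subset {M₁ : Matroid α} {p₁ : α} {M₂ : Matroid β} {p₂ : β}
    {I J : Set (Option (α ⊕ β))} (hJ : SeriesIndep M₁ p₁ M₂ p₂ J) (hIJ : I ⊆ J) :
    SeriesIndep M₁ p₁ M₂ p₂ I := by
  have hl : leftPart I ⊆ leftPart J := fun x hx ↦ hIJ hx
  have hr : rightPart I ⊆ rightPart J := fun x hx ↦ hIJ hx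
  obtain ⟨⟨h1, h2⟩, ⟨h3, h4⟩, h5⟩ := hJ
  refine ⟨⟨h1.subset hl, fun h ↦ h2 (hl h)⟩, ⟨h3.subset hr, fun h ↦ h4 (hr h)⟩, fun hn ↦ ?_⟩
  exact (h5 (hIJ hn)).imp (fun h ↦ h.subset (insert_subset_insert hl))
    (fun h ↦ h.subset (insert_subset_insert hr))

theorem SeriesIndep.augment {M₁ : Matroid α} {p₁ : α} {M₂ : Matroid β} {p₂ : β}
    {I J : Set (Option (α ⊕ β))} (hI : SeriesIndep M₁ p₁ M₂ p₂ I)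
    (hJ : SeriesIndep M₁ p₁ M₂ p₂ J) (hIf : I.Finite) (hJf : J.Finite) (hlt : I.ncard < J.ncard) :
    ∃ e ∈ J, e ∉ I ∧ SeriesIndep M₁ p₁ M₂ p₂ (insert e I) := by
  obtain ⟨fLI, fRI, cI, cI'⟩ := ncard_parts I hIf
  obtain ⟨fLJ, fRJ, cJ, cJ'⟩ := ncard_parts J hJf
  obtain ⟨⟨hLI, pLI⟩, ⟨hRI, pRI⟩, hnI⟩ := hI
  obtain ⟨⟨hLJ, pLJ⟩, ⟨hRJ, pRJ⟩, hnJ⟩ := hJ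
  have addL : ∀ e ∈ leftPart J, e ∉ leftPart I → M₁.Indep (insert e (leftPart I)) →
      (none ∈ I → M₁.Indep (insert p₁ (insert e (leftPart I))) ∨
        M₂.Indep (insert p₂ (rightPart I))) →
      ∃ e ∈ J, e ∉ I ∧ SeriesIndep M₁ p₁ M₂ p₂ (insert e I) := by
    intro e heJ heI h1 h2
    refine ⟨some (Sum.inl e), heJ, heI, ⟨by simpa using h1, ?_⟩, ⟨by simpa using hRI, by simpa⟩,
      by simpa using h2⟩
    simp only [leftPart_insert_inl, mem_insert_iff, pLI, or_false]
    rintro rfl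
    exact pLJ heJ
  have addR : ∀ e ∈ rightPart J, e ∉ rightPart I → M₂.Indep (insert e (rightPart I)) →
      (none ∈ I → M₁.Indep (insert p₁ (leftPart I)) ∨
        M₂.Indep (insert p₂ (insert e (rightPart I)))) →
      ∃ e ∈ J, e ∉ I ∧ SeriesIndep M₁ p₁ M₂ p₂ (insert e I) := by
    intro e heJ heI h1 h2
    refine ⟨some (Sum.inr e), heJ, heI, ⟨by simpa using hLI, by simpa⟩, ⟨by simpa using h1, ?_⟩,
      by simpa using h2⟩
    simp only [rightPart_insert_inr, mem_insert_iff, pRI, or_false]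
    rintro rfl
    exact pRJ heJ
  have addN : none ∉ I → none ∈ J → (M₁.Indep (insert p₁ (leftPart I)) ∨
        M₂.Indep (insert p₂ (rightPart I))) →
      ∃ e ∈ J, e ∉ I ∧ SeriesIndep M₁ p₁ M₂ p₂ (insert e I) := by
    intro h1 h2 h3
    exact ⟨none, h2, h1, ⟨by simpa using hLI, by simpa⟩, ⟨by simpa using hRI, by simpa⟩,
      by simpa using h3⟩
  have cLI := ncard_insert_of_notMem pLI fLI
  have cRI := ncard_insert_of_notMem pRI fRI
  have cLJ := ncard_insert_of_notMem pLJ fLJ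
  have cRJ := ncard_insert_of_notMem pRJ fRJ
  by_cases nI : none ∈ I
  · -- extend the side of `I` that carries the basepoint, or the other side
    have cI := cI' nI
    by_cases nJ : none ∈ J
    · have cJ := cJ' nJ
      rcases hnJ nJ with h | h
      · by_cases hi : M₁.Indep (insert p₁ (leftPart I))
        · by_cases hc : (leftPart I).ncard < (leftPart J).ncard
          · obtain ⟨e, heJ, heI, hi'⟩ := hi.exists_augment h (fLI.insert _) (fLJ.insert _) (by omega)
            rw [mem_insert_iff, not_or] at heI
            refine addL e (by simpa [heI.1] using heJ) heI.2
              (hi'.subset (insert_subset_insert (subset_insert _ _))) fun _ ↦ Or.inl ?_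
            rwa [insert_comm]
          · obtain ⟨e, heJ, heI, hi'⟩ := hRI.exists_augment hRJ fRI fRJ (by omega)
            exact addR e heJ heI hi' fun _ ↦ Or.inl hi
        · have hi2 := (hnI nI).resolve_left hi
          by_cases hc : (leftPart I).ncard < (insert p₁ (leftPart J)).ncard
          · obtain ⟨e, heJ, heI, hi'⟩ := hLI.exists_augment h fLI (fLJ.insert _) hc
            rcases heJ with rfl | heJ
            · exact absurd hi' hi
            · exact addL e heJ heI hi' fun _ ↦ Or.inr hi2
          · obtain ⟨e, heJ, heI, hi'⟩ := hi2.exists_augment hRJ (fRI.insert _) fRJ (by omega)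
            rw [mem_insert_iff, not_or] at heI
            refine addR e heJ heI.2
              (hi'.subset (insert_subset_insert (subset_insert _ _))) fun _ ↦ Or.inr ?_
            rwa [insert_comm]
      · by_cases hi : M₂.Indep (insert p₂ (rightPart I))
        · by_cases hc : (rightPart I).ncard < (rightPart J).ncard
          · obtain ⟨e, heJ, heI, hi'⟩ := hi.exists_augment h (fRI.insert _) (fRJ.insert _) (by omega)
            rw [mem_insert_iff, not_or] at heI
            refine addR e (by simpa [heI.1] using heJ) heI.2
              (hi'.subset (insert_subset_insert (subset_insert _ _))) fun _ ↦ Or.inr ?_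
            rwa [insert_comm]
          · obtain ⟨e, heJ, heI, hi'⟩ := hLI.exists_augment hLJ fLI fLJ (by omega)
            exact addL e heJ heI hi' fun _ ↦ Or.inr hi
        · have hi2 := (hnI nI).resolve_right hi
          by_cases hc : (rightPart I).ncard < (insert p₂ (rightPart J)).ncard
          · obtain ⟨e, heJ, heI, hi'⟩ := hRI.exists_augment h fRI (fRJ.insert _) hc
            rcases heJ with rfl | heJ
            · exact absurd hi' hi
            · exact addR e heJ heI hi' fun _ ↦ Or.inl hi2
          · obtain ⟨e, heJ, heI, hi'⟩ := hi2.exists_augment hLJ (fLI.insert _) fLJ (by omega)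
            rw [mem_insert_iff, not_or] at heI
            refine addL e heJ heI.2
              (hi'.subset (insert_subset_insert (subset_insert _ _))) fun _ ↦ Or.inl ?_
            rwa [insert_comm]
    · have cJ := cJ nJ
      rcases hnI nI with hi | hi
      · by_cases hc : (rightPart I).ncard < (rightPart J).ncard
        · obtain ⟨e, heJ, heI, hi'⟩ := hRI.exists_augment hRJ fRI fRJ hc
          exact addR e heJ heI hi' fun _ ↦ Or.inl hi
        · obtain ⟨e, heJ, heI, hi'⟩ := hi.exists_augment hLJ (fLI.insert _) fLJ (by omega)
          rw [mem_insert_iff, not_or] at heI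
          refine addL e heJ heI.2
            (hi'.subset (insert_subset_insert (subset_insert _ _))) fun _ ↦ Or.inl ?_
          rwa [insert_comm]
      · by_cases hc : (leftPart I).ncard < (leftPart J).ncard
        · obtain ⟨e, heJ, heI, hi'⟩ := hLI.exists_augment hLJ fLI fLJ hc
          exact addL e heJ heI hi' fun _ ↦ Or.inr hi
        · obtain ⟨e, heJ, heI, hi'⟩ := hi.exists_augment hRJ (fRI.insert _) fRJ (by omega)
          rw [mem_insert_iff, not_or] at heI
          refine addR e heJ heI.2
            (hi'.subset (insert_subset_insert (subset_insert _ _))) fun _ ↦ Or.inr ?_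
          rwa [insert_comm]
  · have cI := cI nI
    by_cases nJ : none ∈ J
    · have cJ := cJ' nJ
      rcases hnJ nJ with h | h
      · by_cases hc : (rightPart I).ncard < (rightPart J).ncard
        · obtain ⟨e, heJ, heI, hi'⟩ := hRI.exists_augment hRJ fRI fRJ hc
          exact addR e heJ heI hi' fun h' ↦ absurd h' nI
        · obtain ⟨e, heJ, heI, hi'⟩ := hLI.exists_augment h fLI (fLJ.insert _) (by omega)
          rcases heJ with rfl | heJ
          · exact addN nI nJ (Or.inl hi')
          · exact addL e heJ heI hi' fun h' ↦ absurd h' nI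
      · by_cases hc : (leftPart I).ncard < (leftPart J).ncard
        · obtain ⟨e, heJ, heI, hi'⟩ := hLI.exists_augment hLJ fLI fLJ hc
          exact addL e heJ heI hi' fun h' ↦ absurd h' nI
        · obtain ⟨e, heJ, heI, hi'⟩ := hRI.exists_augment h fRI (fRJ.insert _) (by omega)
          rcases heJ with rfl | heJ
          · exact addN nI nJ (Or.inr hi')
          · exact addR e heJ heI hi' fun h' ↦ absurd h' nI
    · have cJ := cJ nJ
      by_cases hc : (leftPart I).ncard < (leftPart J).ncard
      · obtain ⟨e, heJ, heI, hi'⟩ := hLI.exists_augment hLJ fLI fLJ hc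
        exact addL e heJ heI hi' fun h' ↦ absurd h' nI
      · obtain ⟨e, heJ, heI, hi'⟩ := hRI.exists_augment hRJ fRI fRJ (by omega)
        exact addR e heJ heI hi' fun h' ↦ absurd h' nI

/-- The series connection `S((M₁; p₁), (M₂; p₂))` of two finite matroids with respect to
basepoints `p₁ ∈ E(M₁)` and `p₂ ∈ E(M₂)`. Its ground set is the disjoint union of `E(M₁) - p₁`,
`E(M₂) - p₂` and a new element `none`, the basepoint of the connection. Its circuits are the
standard ones, see `seriesConnection_isCircuit_iff`. -/
def seriesConnection (M₁ : Matroid α) [M₁.Finite] (p₁ : α) (M₂ : Matroid β) [M₂.Finite] (p₂ : β) :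
    Matroid (Option (α ⊕ β)) :=
  have hfin : (insert (none : Option (α ⊕ β)) ((fun x : α ↦ some (Sum.inl x)) '' (M₁.E \ {p₁}) ∪
      (fun x : β ↦ some (Sum.inr x)) '' (M₂.E \ {p₂}))).Finite :=
    (((M₁.ground_finite.subset sdiff_subset).image _).union
      ((M₂.ground_finite.subset sdiff_subset).image _)).insert _
  have hsub : ∀ ⦃I⦄, SeriesIndep M₁ p₁ M₂ p₂ I →
      I ⊆ insert (none : Option (α ⊕ β)) ((fun x : α ↦ some (Sum.inl x)) '' (M₁.E \ {p₁}) ∪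
      (fun x : β ↦ some (Sum.inr x)) '' (M₂.E \ {p₂})) := by
    rintro I ⟨⟨h1, h2⟩, ⟨h3, h4⟩, -⟩ (_ | x | x) hx
    · simp
    · have : x ≠ p₁ := by rintro rfl; exact h2 hx
      simpa [this] using h1.subset_ground hx
    · have : x ≠ p₂ := by rintro rfl; exact h4 hx
      simpa [this] using h3.subset_ground hx
  (IndepMatroid.ofFinite (E := insert none ((fun x : α ↦ some (Sum.inl x)) '' (M₁.E \ {p₁}) ∪
      (fun x : β ↦ some (Sum.inr x)) '' (M₂.E \ {p₂}))) hfin (SeriesIndep M₁ p₁ M₂ p₂)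
    (by simp [SeriesIndep, leftPart, rightPart])
    (fun _ _ hJ hIJ ↦ hJ.subset hIJ)
    (fun _ _ hI hJ hlt ↦ hI.augment hJ (hfin.subset (hsub hI)) (hfin.subset (hsub hJ)) hlt)
    hsub).matroid

theorem seriesConnection_ground (M₁ : Matroid α) [M₁.Finite] (p₁ : α) (M₂ : Matroid β) [M₂.Finite]
    (p₂ : β) : (seriesConnection M₁ p₁ M₂ p₂).E =
      insert none ((fun x : α ↦ some (Sum.inl x)) '' (M₁.E \ {p₁}) ∪
      (fun x : β ↦ some (Sum.inr x)) '' (M₂.E \ {p₂})) := rfl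

theorem seriesConnection_indep_iff (M₁ : Matroid α) [M₁.Finite] (p₁ : α) (M₂ : Matroid β)
    [M₂.Finite] (p₂ : β) (I : Set (Option (α ⊕ β))) :
    (seriesConnection M₁ p₁ M₂ p₂).Indep I ↔ SeriesIndep M₁ p₁ M₂ p₂ I := Iff.rfl

/-- The three kinds of circuits of the series connection. -/
inductive SeriesCircuit (M₁ : Matroid α) (p₁ : α) (M₂ : Matroid β) (p₂ : β) :
    Set (Option (α ⊕ β)) → Prop
  | left (C₁ : Set α) (h : M₁.IsCircuit C₁) (hp : p₁ ∉ C₁) :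
      SeriesCircuit M₁ p₁ M₂ p₂ ((fun x : α ↦ some (Sum.inl x)) '' C₁)
  | right (C₂ : Set β) (h : M₂.IsCircuit C₂) (hp : p₂ ∉ C₂) :
      SeriesCircuit M₁ p₁ M₂ p₂ ((fun x : β ↦ some (Sum.inr x)) '' C₂)
  | through (C₁ : Set α) (C₂ : Set β) (h₁ : M₁.IsCircuit C₁) (hp₁ : p₁ ∈ C₁)
      (h₂ : M₂.IsCircuit C₂) (hp₂ : p₂ ∈ C₂) :
      SeriesCircuit M₁ p₁ M₂ p₂ (insert none ((fun x : α ↦ some (Sum.inl x)) '' (C₁ \ {p₁}) ∪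
        (fun x : β ↦ some (Sum.inr x)) '' (C₂ \ {p₂})))

/-- The circuits of the series connection are the circuits of `M₁` avoiding `p₁`, the circuits of
`M₂` avoiding `p₂`, and the sets `(C₁ - p₁) ∪ (C₂ - p₂) ∪ {p}`, where `C₁` and `C₂` are circuits
of `M₁` and `M₂` through `p₁` and `p₂`, and `p = none` is the basepoint of the connection. -/
theorem seriesConnection_isCircuit_iff (M₁ : Matroid α) [M₁.Finite] (p₁ : α) (M₂ : Matroid β)
    [M₂.Finite] (p₂ : β) (hp₁ : p₁ ∈ M₁.E) (hp₂ : p₂ ∈ M₂.E) (C : Set (Option (α ⊕ β))) :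
    (seriesConnection M₁ p₁ M₂ p₂).IsCircuit C ↔ SeriesCircuit M₁ p₁ M₂ p₂ C := by
  have hdep : ∀ C, SeriesCircuit M₁ p₁ M₂ p₂ C → (seriesConnection M₁ p₁ M₂ p₂).Dep C := by
    rintro _ (⟨C₁, h, hp⟩ | ⟨C₂, h, hp⟩ | ⟨C₁, C₂, h₁, hp₁, h₂, hp₂⟩)
    · refine ⟨fun hi ↦ h.not_indep ?_, ?_⟩
      · simpa [leftPart] using hi.1.1
      · rintro _ ⟨x, hx, rfl⟩
        have : x ≠ p₁ := by rintro rfl; exact hp hx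
        simpa [seriesConnection_ground, this] using h.subset_ground hx
    · refine ⟨fun hi ↦ h.not_indep ?_, ?_⟩
      · simpa [rightPart] using hi.2.1.1
      · rintro _ ⟨x, hx, rfl⟩
        have : x ≠ p₂ := by rintro rfl; exact hp hx
        simpa [seriesConnection_ground, this] using h.subset_ground hx
    · refine ⟨fun hi ↦ ?_, insert_subset_insert (union_subset_union
        (image_mono (sdiff_subset_sdiff_left h₁.subset_ground))
        (image_mono (sdiff_subset_sdiff_left h₂.subset_ground)))⟩
      rcases hi.2.2 (by simp) with hi | hi
      · refine h₁.not_indep (hi.subset fun x hx ↦ ?_)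
        by_cases hxp : x = p₁ <;> simp [leftPart, hxp, hx]
      · refine h₂.not_indep (hi.subset fun x hx ↦ ?_)
        by_cases hxp : x = p₂ <;> simp [rightPart, hxp, hx]
  have hex : ∀ D, (seriesConnection M₁ p₁ M₂ p₂).Dep D →
      ∃ C ⊆ D, SeriesCircuit M₁ p₁ M₂ p₂ C := by
    rintro D ⟨hD, hDE⟩
    have hl : ∀ x ∈ leftPart D, x ∈ M₁.E ∧ x ≠ p₁ := by
      intro x hx
      simpa [seriesConnection_ground] using hDE hx
    have hr : ∀ x ∈ rightPart D, x ∈ M₂.E ∧ x ≠ p₂ := by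
      intro x hx
      simpa [seriesConnection_ground] using hDE hx
    by_cases h1 : M₁.Indep (leftPart D)
    swap
    · obtain ⟨C, hCD, hC⟩ := Dep.exists_isCircuit_subset ⟨h1, fun x hx ↦ (hl x hx).1⟩
      refine ⟨_, ?_, .left C hC fun hp ↦ (hl _ (hCD hp)).2 rfl⟩
      rintro _ ⟨x, hx, rfl⟩
      exact hCD hx
    by_cases h2 : M₂.Indep (rightPart D)
    swap
    · obtain ⟨C, hCD, hC⟩ := Dep.exists_isCircuit_subset ⟨h2, fun x hx ↦ (hr x hx).1⟩
      refine ⟨_, ?_, .right C hC fun hp ↦ (hr _ (hCD hp)).2 rfl⟩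
      rintro _ ⟨x, hx, rfl⟩
      exact hCD hx
    have h3 : none ∈ D ∧ ¬ M₁.Indep (insert p₁ (leftPart D)) ∧
        ¬ M₂.Indep (insert p₂ (rightPart D)) := by
      by_contra hcon
      refine hD ⟨⟨h1, fun h ↦ (hl _ h).2 rfl⟩, ⟨h2, fun h ↦ (hr _ h).2 rfl⟩, fun hn ↦ ?_⟩
      tauto
    obtain ⟨hn, h3, h4⟩ := h3
    obtain ⟨C₁, hCD₁, hC₁⟩ := Dep.exists_isCircuit_subset
      ⟨h3, insert_subset hp₁ fun x hx ↦ (hl x hx).1⟩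
    obtain ⟨C₂, hCD₂, hC₂⟩ := Dep.exists_isCircuit_subset
      ⟨h4, insert_subset hp₂ fun x hx ↦ (hr x hx).1⟩
    refine ⟨_, ?_, .through C₁ C₂ hC₁ ?_ hC₂ ?_⟩
    · refine insert_subset hn (union_subset ?_ ?_)
      · rintro _ ⟨x, ⟨hx, hxp⟩, rfl⟩
        exact (hCD₁ hx).resolve_left hxp
      · rintro _ ⟨x, ⟨hx, hxp⟩, rfl⟩
        exact (hCD₂ hx).resolve_left hxp
    · by_contra hp
      exact hC₁.not_indep (h1.subset ((subset_insert_iff_of_notMem hp).1 hCD₁))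
    · by_contra hp
      exact hC₂.not_indep (h2.subset ((subset_insert_iff_of_notMem hp).1 hCD₂))
  have hanti : ∀ C D, SeriesCircuit M₁ p₁ M₂ p₂ C → SeriesCircuit M₁ p₁ M₂ p₂ D → C ⊆ D →
      D ⊆ C := by
    rintro _ _ (⟨C₁, h, hp⟩ | ⟨C₂, h, hp⟩ | ⟨C₁, C₂, h₁, hp₁, h₂, hp₂⟩)
      (⟨D₁, h', hp'⟩ | ⟨D₂, h', hp'⟩ | ⟨D₁, D₂, h₁', hp₁', h₂', hp₂'⟩) hCD
    · have : C₁ ⊆ D₁ := fun x hx ↦ by simpa using hCD ⟨x, hx, rfl⟩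
      rw [h.eq_of_subset_isCircuit h' this]
    · obtain ⟨x, hx⟩ := h.nonempty
      simpa using hCD ⟨x, hx, rfl⟩
    · have : C₁ ⊆ D₁ \ {p₁} := fun x hx ↦ by simpa using hCD ⟨x, hx, rfl⟩
      rw [h.eq_of_subset_isCircuit h₁' (this.trans sdiff_subset)] at hp
      exact absurd hp₁' hp
    · obtain ⟨x, hx⟩ := h.nonempty
      simpa using hCD ⟨x, hx, rfl⟩
    · have : C₂ ⊆ D₂ := fun x hx ↦ by simpa using hCD ⟨x, hx, rfl⟩
      rw [h.eq_of_subset_isCircuit h' this]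
    · have : C₂ ⊆ D₂ \ {p₂} := fun x hx ↦ by simpa using hCD ⟨x, hx, rfl⟩
      rw [h.eq_of_subset_isCircuit h₂' (this.trans sdiff_subset)] at hp
      exact absurd hp₂' hp
    · simpa using hCD (mem_insert _ _)
    · simpa using hCD (mem_insert _ _)
    · have e₁ : C₁ ⊆ D₁ := fun x hx ↦ by
        by_cases hxp : x = p₁
        · rwa [hxp]
        · have : some (Sum.inl x) ∈ _ := hCD (Or.inr (Or.inl ⟨x, ⟨hx, hxp⟩, rfl⟩))
          simp at this
          exact this.1
      have e₂ : C₂ ⊆ D₂ := fun x hx ↦ by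
        by_cases hxp : x = p₂
        · rwa [hxp]
        · have : some (Sum.inr x) ∈ _ := hCD (Or.inr (Or.inr ⟨x, ⟨hx, hxp⟩, rfl⟩))
          simp at this
          exact this.1
      rw [h₁.eq_of_subset_isCircuit h₁' e₁, h₂.eq_of_subset_isCircuit h₂' e₂]
  constructor
  · intro hC
    obtain ⟨C', hC'C, hC'⟩ := hex C hC.dep
    rwa [← hC.eq_of_dep_subset (hdep _ hC') hC'C]
  · intro hC
    refine ⟨hdep C hC, fun D hD hDC ↦ ?_⟩
    obtain ⟨C', hC'D, hC'⟩ := hex D hD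
    exact (hanti C' C hC' hC (hC'D.trans hDC)).trans hC'D

end SeriesConnection

end Matroid

/-! Everything passes through a circuit-only form of skewness: two distinct circuits are skew
exactly when their union contains no third circuit (`hasSkewCircuits_iff`). If a third circuit
exists, it meets both, so any two elements of the union lie in a common circuit inside it
(`isConnectedSet_union_of_not_isSkewPair`); the union of a skew pair has no such connectivity.

Without skew pairs, strong elimination at `e`, applied once to keep `e₁` and once to keep `e₂`,
gives two circuits whose union is connected, hence (i). Conversely, given (i) and a skew pair, a
circuit that meets both members and has fewest elements outside them can be improved, a
contradiction.

For (iv), complements of flats of `M✶` are unions of circuits of `M`, and contracting `M✶` by `F` is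
dual to deleting `F` from `M`. Unbreakability of `M✶` thus says that unions of circuits are
connected sets, and unions of two circuits decide this.

For (iii), the series connection of two such uniform matroids has a visible skew pair, and skew
pairs lift from series minors. Conversely, take a connected series minor that is minimal with a skew
pair `C₁`, `C₂`. Minimality makes all elements outside `C₁ ∪ C₂` lie in the same circuits, so there
is just one, `p`. A circuit through `p` omits exactly one element of each `Cᵢ`, and every choice of
the two occurs. This is the circuit list of the series connection. -/

namespace Matroid

open Set

variable {α : Type*} {M : Matroid α} {C₁ C₂ D X Y : Set α} {e f g : α}

/-! ### Connected sets of elements -/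

/-- Two intersecting circuits have circuits through any two of their elements. -/
theorem IsCircuit.exists_mem_mem_of_inter_nonempty [M.Finitary] (h₁ : M.IsCircuit C₁)
    (h₂ : M.IsCircuit C₂) (hne : (C₁ ∩ C₂).Nonempty) (he : e ∈ C₁) (hf : f ∈ C₂) :
    ∃ C ⊆ C₁ ∪ C₂, M.IsCircuit C ∧ e ∈ C ∧ f ∈ C := by
  induction hn : (C₁ ∪ C₂).ncard using Nat.strong_induction_on generalizing C₁ C₂ with
  | _ n ih =>
  subst hn
  have hfin : (C₁ ∪ C₂).Finite := h₁.finite.union h₂.finite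
  have key : ∀ D₁ D₂, M.IsCircuit D₁ → M.IsCircuit D₂ → (D₁ ∩ D₂).Nonempty → e ∈ D₁ → f ∈ D₂ →
      D₁ ∪ D₂ ⊂ C₁ ∪ C₂ → ∃ C ⊆ C₁ ∪ C₂, M.IsCircuit C ∧ e ∈ C ∧ f ∈ C := by
    intro D₁ D₂ hD₁ hD₂ hne he hf hss
    obtain ⟨C, hC, h⟩ := ih _ (ncard_lt_ncard hss hfin) hD₁ hD₂ hne he hf rfl
    exact ⟨C, hC.trans hss.subset, h⟩
  by_cases he₂ : e ∈ C₂
  · exact ⟨C₂, subset_union_right, h₂, he₂, hf⟩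
  by_cases hf₁ : f ∈ C₁
  · exact ⟨C₁, subset_union_left, h₁, he, hf₁⟩
  obtain ⟨g, hg₁, hg₂⟩ := hne
  obtain ⟨C₃, hC₃, h₃, he₃⟩ := h₁.strong_elimination h₂ hg₁ hg₂ he he₂
  obtain ⟨C₄, hC₄, h₄, hf₄⟩ := h₂.strong_elimination h₁ hg₂ hg₁ hf hf₁
  rw [union_comm] at hC₄
  have hC₃' := hC₃.trans sdiff_subset
  have hC₄' := hC₄.trans sdiff_subset
  have hg₃ : g ∉ C₃ := fun h ↦ (hC₃ h).2 rfl
  have hg₄ : g ∉ C₄ := fun h ↦ (hC₄ h).2 rfl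
  -- `y` lies in `C₂` only. If `y ∈ C₄`, then `C₃` and `C₄` meet and their union loses `g`;
  -- otherwise `C₄` meets `C₁` outside `C₂`, and `C₁ ∪ C₄` loses `y`. Either way the induction
  -- applies.
  obtain ⟨y, hy₃, hy₁⟩ : ∃ y ∈ C₃, y ∉ C₁ := by
    by_contra! hcon
    exact hg₃ (h₃.eq_of_subset_isCircuit h₁ hcon ▸ hg₁)
  have hy₂ := (hC₃' hy₃).resolve_left hy₁
  by_cases hy₄ : y ∈ C₄
  · refine key C₃ C₄ h₃ h₄ ⟨y, hy₃, hy₄⟩ he₃ hf₄ ⟨union_subset hC₃' hC₄', fun hss ↦ ?_⟩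
    exact (hss (Or.inl hg₁)).elim hg₃ hg₄
  · obtain ⟨z, hz₄, hz₂⟩ : ∃ z ∈ C₄, z ∉ C₂ := by
      by_contra! hcon
      exact hg₄ (h₄.eq_of_subset_isCircuit h₂ hcon ▸ hg₂)
    refine key C₁ C₄ h₁ h₄ ⟨z, (hC₄' hz₄).resolve_right hz₂, hz₄⟩ he hf₄
      ⟨union_subset subset_union_left hC₄', fun hss ↦ ?_⟩
    exact (hss (Or.inr hy₂)).elim hy₁ hy₄

/-- Any two elements of `X` lie in a common circuit contained in `X`. -/
def IsConnectedSet (M : Matroid α) (X : Set α) : Prop :=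
  ∀ ⦃e f : α⦄, e ∈ X → f ∈ X → e ≠ f → ∃ C ⊆ X, M.IsCircuit C ∧ e ∈ C ∧ f ∈ C

theorem IsCircuit.isConnectedSet (h : M.IsCircuit D) : M.IsConnectedSet D :=
  fun _ _ he hf _ ↦ ⟨D, subset_rfl, h, he, hf⟩

theorem IsConnectedSet.union [M.Finitary] (hX : M.IsConnectedSet X) (hY : M.IsConnectedSet Y)
    (hne : (X ∩ Y).Nonempty) : M.IsConnectedSet (X ∪ Y) := by
  have key : ∀ {X Y : Set α}, M.IsConnectedSet X → M.IsConnectedSet Y → (X ∩ Y).Nonempty →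
      ∀ e ∈ X, ∀ f ∈ Y, e ≠ f → ∃ C ⊆ X ∪ Y, M.IsCircuit C ∧ e ∈ C ∧ f ∈ C := by
    rintro X Y hX hY ⟨g, hgX, hgY⟩ e he f hf hef
    obtain rfl | heg := eq_or_ne e g
    · obtain ⟨C, hC, h⟩ := hY hgY hf hef
      exact ⟨C, hC.trans subset_union_right, h⟩
    obtain rfl | hfg := eq_or_ne f g
    · obtain ⟨C, hC, h⟩ := hX he hgX hef
      exact ⟨C, hC.trans subset_union_left, h⟩
    obtain ⟨C, hCX, hC, heC, hgC⟩ := hX he hgX heg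
    obtain ⟨C', hCY, hC', hfC', hgC'⟩ := hY hf hgY hfg
    obtain ⟨K, hK, h⟩ := hC.exists_mem_mem_of_inter_nonempty hC' ⟨g, hgC, hgC'⟩ heC hfC'
    exact ⟨K, hK.trans (union_subset_union hCX hCY), h⟩
  rintro e f (he | he) (hf | hf) hef
  · obtain ⟨C, hC, h⟩ := hX he hf hef
    exact ⟨C, hC.trans subset_union_left, h⟩
  · exact key hX hY hne e he f hf hef
  · obtain ⟨C, hC, h, h'⟩ := key hX hY hne f hf e he hef.symm
    exact ⟨C, hC, h, h'.symm⟩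
  · obtain ⟨C, hC, h⟩ := hY he hf hef
    exact ⟨C, hC.trans subset_union_right, h⟩

theorem isConnected_iff_isConnectedSet_ground : M.IsConnected ↔ M.IsConnectedSet M.E := by
  refine ⟨fun h e f he hf hef ↦ ?_, fun h e f he hf hef ↦ ?_⟩
  · obtain ⟨C, hC, h⟩ := h he hf hef
    exact ⟨C, hC.subset_ground, hC, h⟩
  · obtain ⟨C, -, hC⟩ := h he hf hef
    exact ⟨C, hC⟩

/-! ### Skew pairs of circuits -/

/-- Two distinct circuits that are the only circuits in their union. -/
structure IsSkewPair (M : Matroid α) (C₁ C₂ : Set α) : Prop where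
  left : M.IsCircuit C₁
  right : M.IsCircuit C₂
  ne : C₁ ≠ C₂
  eq_or_eq : ∀ ⦃D⦄, M.IsCircuit D → D ⊆ C₁ ∪ C₂ → D = C₁ ∨ D = C₂

theorem IsSkewPair.symm (h : M.IsSkewPair C₁ C₂) : M.IsSkewPair C₂ C₁ :=
  ⟨h.right, h.left, h.ne.symm, fun _ hD hss ↦ (h.eq_or_eq hD (by rwa [union_comm])).symm⟩

theorem IsSkewPair.disjoint (h : M.IsSkewPair C₁ C₂) : Disjoint C₁ C₂ := by
  refine disjoint_left.2 fun g hg₁ hg₂ ↦ ?_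
  obtain ⟨D, hD, hDc⟩ := h.left.elimination h.right h.ne g
  have hg : g ∉ D := fun h ↦ (hD h).2 rfl
  obtain rfl | rfl := h.eq_or_eq hDc (hD.trans sdiff_subset)
  exacts [hg hg₁, hg hg₂]

/-- Dropping one element from each circuit destroys the only two circuits in the union, so the
remainder is an independent set of size `r(C₁) + r(C₂)`. -/
theorem IsSkewPair.isSkew (h : M.IsSkewPair C₁ C₂) : M.IsSkew C₁ C₂ := by
  obtain ⟨x, hx⟩ := h.left.nonempty
  obtain ⟨y, hy⟩ := h.right.nonempty
  have hdj := disjoint_left.1 h.disjoint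
  have hI : M.Indep (C₁ \ {x} ∪ C₂ \ {y}) := by
    rw [indep_iff_forall_subset_not_isCircuit (union_subset
      (sdiff_subset.trans h.left.subset_ground) (sdiff_subset.trans h.right.subset_ground))]
    intro D hD hDc
    obtain rfl | rfl := h.eq_or_eq hDc (hD.trans (union_subset_union sdiff_subset sdiff_subset))
    · exact (hD hx).elim (fun h ↦ h.2 rfl) fun h ↦ hdj hx h.1
    · exact (hD hy).elim (fun h ↦ hdj h.1 hy) fun h ↦ h.2 rfl
  refine le_antisymm ?_ (M.eRk_union_le_eRk_add_eRk _ _)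
  rw [← (h.left.sdiff_singleton_isBasis hx).encard_eq_eRk,
    ← (h.right.sdiff_singleton_isBasis hy).encard_eq_eRk,
    ← encard_union_eq (h.disjoint.mono sdiff_subset sdiff_subset)]
  exact hI.encard_le_eRk_of_subset (union_subset_union sdiff_subset sdiff_subset)

/-- A third circuit `D` would meet each `Cᵢ` in an independent set, which extends to a basis `Iᵢ` of
`Cᵢ`. By skewness `I₁ ∪ I₂` has at most as many elements as its rank, so it is independent, yet it
contains `D`. -/
theorem IsSkew.isSkewPair [M.Finite] (h : M.IsSkew C₁ C₂) (h₁ : M.IsCircuit C₁)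
    (h₂ : M.IsCircuit C₂) (hne : C₁ ≠ C₂) : M.IsSkewPair C₁ C₂ := by
  refine ⟨h₁, h₂, hne, fun D hD hss ↦ ?_⟩
  by_contra! hcon
  have hi : ∀ C, M.IsCircuit C → D ≠ C → ¬ C ⊆ D := fun C hC hne hCD ↦
    hne (hC.eq_of_subset_isCircuit hD hCD).symm
  have hDi : ∀ C, M.IsCircuit C → D ≠ C → M.Indep (D ∩ C) := fun C hC hne ↦
    hC.ssubset_indep (inter_subset_right.ssubset_of_ne fun h ↦ hi C hC hne (inter_eq_right.1 h))
  obtain ⟨I₁, hI₁, hDI₁⟩ := (hDi C₁ h₁ hcon.1).subset_isBasis_of_subset inter_subset_right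
    h₁.subset_ground
  obtain ⟨I₂, hI₂, hDI₂⟩ := (hDi C₂ h₂ hcon.2).subset_isBasis_of_subset inter_subset_right
    h₂.subset_ground
  have hE : I₁ ∪ I₂ ⊆ M.E := union_subset hI₁.indep.subset_ground hI₂.indep.subset_ground
  refine hD.not_indep (Indep.subset (J := I₁ ∪ I₂) ?_ ?_)
  · refine (M.isRkFinite_set (I₁ ∪ I₂)).indep_of_encard_le_eRk ?_
    rw [hI₁.eRk_eq_eRk_union, union_comm C₁, hI₂.eRk_eq_eRk_union, union_comm C₂, ← h,
      ← hI₁.encard_eq_eRk, ← hI₂.encard_eq_eRk]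
    exact encard_union_le _ _
  · rw [← inter_eq_left.2 hss, inter_union_distrib_left]
    exact union_subset_union hDI₁ hDI₂

theorem hasSkewCircuits_iff [M.Finite] :
    M.HasSkewCircuits ↔ ∃ C₁ C₂, M.IsSkewPair C₁ C₂ :=
  ⟨fun ⟨C₁, C₂, hne, h₁, h₂, h⟩ ↦ ⟨C₁, C₂, h.isSkewPair h₁ h₂ hne⟩,
    fun ⟨C₁, C₂, h⟩ ↦ ⟨C₁, C₂, h.ne, h.left, h.right, h.isSkew⟩⟩

theorem IsCircuit.exists_inter_nonempty (h₁ : M.IsCircuit C₁) (h₂ : M.IsCircuit C₂)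
    (hD : M.IsCircuit D) (hss : D ⊆ C₁ ∪ C₂) (hne₁ : D ≠ C₁) (hne₂ : D ≠ C₂) :
    (D ∩ C₁).Nonempty ∧ (D ∩ C₂).Nonempty := by
  constructor
  · by_contra hcon
    refine hne₂ (hD.eq_of_subset_isCircuit h₂ fun x hx ↦ (hss hx).resolve_left fun h ↦ ?_)
    exact hcon ⟨x, hx, h⟩
  · by_contra hcon
    refine hne₁ (hD.eq_of_subset_isCircuit h₁ fun x hx ↦ (hss hx).resolve_right fun h ↦ ?_)
    exact hcon ⟨x, hx, h⟩

/-- A third circuit in the union meets both `C₁` and `C₂` and so links them. -/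
theorem isConnectedSet_union_of_not_isSkewPair [M.Finitary] (hM : ¬ M.IsSkewPair C₁ C₂)
    (h₁ : M.IsCircuit C₁) (h₂ : M.IsCircuit C₂) : M.IsConnectedSet (C₁ ∪ C₂) := by
  by_cases hne : C₁ = C₂
  · subst hne
    rw [union_self]
    exact h₁.isConnectedSet
  obtain ⟨D, hD, hss, hne₁, hne₂⟩ : ∃ D, M.IsCircuit D ∧ D ⊆ C₁ ∪ C₂ ∧ D ≠ C₁ ∧ D ≠ C₂ := by
    by_contra! hcon
    exact hM ⟨h₁, h₂, hne, fun D hD hss ↦ or_iff_not_imp_left.2 (hcon D hD hss)⟩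
  obtain ⟨hi₁, hi₂⟩ := h₁.exists_inter_nonempty h₂ hD hss hne₁ hne₂
  have h := (h₁.isConnectedSet.union hD.isConnectedSet (by rwa [inter_comm])).union h₂.isConnectedSet
    (hi₂.mono (inter_subset_inter_left _ subset_union_right))
  rwa [union_right_comm, union_eq_self_of_subset_right hss] at h

theorem IsSkewPair.not_isConnectedSet (h : M.IsSkewPair C₁ C₂) :
    ¬ M.IsConnectedSet (C₁ ∪ C₂) := by
  intro hc
  obtain ⟨x, hx⟩ := h.left.nonempty
  obtain ⟨y, hy⟩ := h.right.nonempty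
  have hdj := disjoint_left.1 h.disjoint
  obtain ⟨C, hCss, hC, hxC, hyC⟩ := hc (Or.inl hx) (Or.inr hy) (fun h ↦ hdj hx (h ▸ hy))
  obtain rfl | rfl := h.eq_or_eq hC hCss
  exacts [hdj hyC hy, hdj hx hxC]

/-! ### Symmetric strong circuit elimination -/

theorem hasSSCE_of_not_isSkewPair [M.Finitary] (hM : ∀ C₁ C₂, ¬ M.IsSkewPair C₁ C₂) :
    M.HasSSCE := by
  rintro C₁ C₂ e₁ e₂ e h₁ h₂ ⟨he₁, he₁'⟩ ⟨he₂, he₂'⟩ ⟨he, he'⟩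
  obtain ⟨D₁, hss₁, hD₁, hm₁⟩ := h₁.strong_elimination h₂ he he' he₁ he₁'
  obtain ⟨D₂, hss₂, hD₂, hm₂⟩ := h₂.strong_elimination h₁ he' he he₂ he₂'
  rw [union_comm] at hss₂
  obtain ⟨C, hC, hCc, h⟩ := isConnectedSet_union_of_not_isSkewPair (hM D₁ D₂) hD₁ hD₂ (Or.inl hm₁)
    (Or.inr hm₂) (fun h ↦ he₁' (h ▸ he₂))
  exact ⟨C, hCc, pair_subset h.1 h.2, hC.trans (union_subset hss₁ hss₂)⟩

/-- If the circuit `D` meets the disjoint circuits `C₁` and `C₂`, then symmetric strong circuit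
elimination between `D` and `C₁` leaves a circuit meeting `C₁` in a prescribed element outside `D`,
and meeting `C₂` inside `D`. -/
theorem HasSSCE.exists_isCircuit (hM : M.HasSSCE) (h₁ : M.IsCircuit C₁) (hD : M.IsCircuit D)
    (hdj : Disjoint C₁ C₂) (hm₁ : (D ∩ C₁).Nonempty) (hm₂ : (D ∩ C₂).Nonempty) :
    ∃ K, M.IsCircuit K ∧ K ⊆ D ∪ C₁ ∧ (K ∩ (C₁ \ D)).Nonempty ∧ (K ∩ C₂).Nonempty := by
  obtain ⟨e, he, he₁⟩ := hm₁
  obtain ⟨a, haD, ha₂⟩ := hm₂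
  have ha₁ : a ∉ C₁ := fun h ↦ disjoint_left.1 hdj h ha₂
  obtain ⟨b, hb₁, hbD⟩ : ∃ b ∈ C₁, b ∉ D := by
    by_contra! hcon
    exact ha₁ (h₁.eq_of_subset_isCircuit hD hcon ▸ haD)
  obtain ⟨K, hK, hab, hKss⟩ := hM hD h₁ ⟨haD, ha₁⟩ ⟨hb₁, hbD⟩ ⟨he, he₁⟩
  exact ⟨K, hK, hKss.trans sdiff_subset, ⟨b, hab (by simp), hb₁, hbD⟩, ⟨a, hab (by simp), ha₂⟩⟩

theorem HasSSCE.not_isSkewPair [M.Finite] (hM : M.HasSSCE) (hc : M.IsConnected) :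
    ¬ M.IsSkewPair C₁ C₂ := by
  intro h
  have hdj := h.disjoint
  obtain ⟨x₁, hx₁⟩ := h.left.nonempty
  obtain ⟨x₂, hx₂⟩ := h.right.nonempty
  have hex : ∃ n, ∃ D, M.IsCircuit D ∧ (D ∩ C₁).Nonempty ∧ (D ∩ C₂).Nonempty ∧
      (D \ (C₁ ∪ C₂)).ncard = n := by
    obtain ⟨D, hD, h₁, h₂⟩ := hc (h.left.subset_ground hx₁) (h.right.subset_ground hx₂)
      (fun h ↦ disjoint_left.1 hdj hx₁ (h ▸ hx₂))
    exact ⟨_, D, hD, ⟨_, h₁, hx₁⟩, ⟨_, h₂, hx₂⟩, rfl⟩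
  classical
  obtain ⟨D, hD, hm₁, hm₂, hn⟩ := Nat.find_spec hex
  -- By the choice of `D`, a competitor within `D ∪ C₁ ∪ C₂` cannot lose any element of `D` outside
  -- `C₁ ∪ C₂`.
  have hmin : ∀ K, M.IsCircuit K → (K ∩ C₁).Nonempty → (K ∩ C₂).Nonempty →
      K ⊆ D ∪ (C₁ ∪ C₂) → D \ (C₁ ∪ C₂) ⊆ K := by
    intro K hK h₁ h₂ hKss
    have hle := Nat.find_min' hex ⟨K, hK, h₁, h₂, rfl⟩
    rw [← hn] at hle
    have hss : K \ (C₁ ∪ C₂) ⊆ D \ (C₁ ∪ C₂) := fun x hx ↦ ⟨(hKss hx.1).resolve_right hx.2, hx.2⟩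
    rw [← eq_of_subset_of_ncard_le hss hle (hD.finite.subset sdiff_subset)]
    exact sdiff_subset
  obtain ⟨x, hxD, hx⟩ : ∃ x ∈ D, x ∉ C₁ ∪ C₂ := by
    by_contra! hcon
    obtain rfl | rfl := h.eq_or_eq hD hcon
    · exact hm₂.ne_empty hdj.inter_eq
    · exact hm₁.ne_empty hdj.symm.inter_eq
  obtain ⟨K₁, hK₁, hss₁, ⟨a, haK, ha₁, haD⟩, hK₁₂⟩ := hM.exists_isCircuit h.left hD hdj hm₁ hm₂
  obtain ⟨K₂, hK₂, hss₂, ⟨b, hbK, hb₂, hbD⟩, hK₂₁⟩ := hM.exists_isCircuit h.right hD hdj.symm hm₂ hm₁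
  have hss₁' : K₁ ⊆ D ∪ (C₁ ∪ C₂) := hss₁.trans (union_subset_union_right _ subset_union_left)
  have hss₂' : K₂ ⊆ D ∪ (C₁ ∪ C₂) := hss₂.trans (union_subset_union_right _ subset_union_right)
  have hxK₁ := hmin K₁ hK₁ ⟨a, haK, ha₁⟩ hK₁₂ hss₁' ⟨hxD, hx⟩
  have hxK₂ := hmin K₂ hK₂ hK₂₁ ⟨b, hbK, hb₂⟩ hss₂' ⟨hxD, hx⟩
  have haK₂ : a ∉ K₂ := fun h ↦ (hss₂ h).elim haD (disjoint_left.1 hdj ha₁)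
  have hbK₁ : b ∉ K₁ := fun h ↦ (hss₁ h).elim hbD (disjoint_right.1 hdj hb₂)
  -- Eliminating `x` while keeping `a ∈ C₁` and `b ∈ C₂` yields a circuit meeting both sides without
  -- `x`, against `hmin`.
  obtain ⟨K, hK, hab, hKss⟩ := hM hK₁ hK₂ ⟨haK, haK₂⟩ ⟨hbK, hbK₁⟩ ⟨hxK₁, hxK₂⟩
  exact (hKss (hmin K hK ⟨a, hab (by simp), ha₁⟩ ⟨b, hab (by simp), hb₂⟩
    (hKss.trans (sdiff_subset.trans (union_subset hss₁' hss₂'))) ⟨hxD, hx⟩)).2 rfl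

/-! ### Duality -/

/-- Extend `C - e` to a base `B`. Then `C` is the fundamental circuit of `e`, and since it contains
`f`, the fundamental cocircuit of `f` contains `e`. -/
theorem IsConnected.dual (h : M.IsConnected) : M✶.IsConnected := by
  intro e f he hf hef
  obtain ⟨C, hC, heC, hfC⟩ := h he hf hef
  obtain ⟨B, hB, hCB⟩ := (hC.sdiff_singleton_indep heC).exists_isBase_superset
  have hfB : f ∈ B := hCB ⟨hfC, hef.symm⟩
  have heB : e ∉ B := fun h ↦ hC.not_indep (hB.indep.subset fun x hx ↦ by
    by_cases hxe : x = e
    · rwa [hxe]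
    · exact hCB ⟨hx, hxe⟩)
  refine ⟨_, (fundCocircuit_isCocircuit hfB hB).isCircuit, ?_, M.mem_fundCocircuit f B⟩
  rw [hB.mem_fundCocircuit_iff_mem_fundCircuit]
  rwa [← hC.eq_fundCircuit_of_subset hB.indep]
  rwa [← sdiff_singleton_subset_iff]

theorem isConnected_dual_iff : M✶.IsConnected ↔ M.IsConnected :=
  ⟨fun h ↦ by simpa using h.dual, fun h ↦ h.dual⟩

theorem isConnected_dual_contract_iff {F : Set α} :
    (M✶.contract F).IsConnected ↔ M.IsConnectedSet (M.E \ F) := by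
  rw [← dual_delete, isConnected_dual_iff]
  refine ⟨fun h e f he hf hef ↦ ?_, fun h e f he hf hef ↦ ?_⟩
  · obtain ⟨C, hC, h⟩ := h he hf hef
    exact ⟨C, hC.subset_ground, hC.of_delete, h⟩
  · obtain ⟨C, hCss, hC, h⟩ := h he hf hef
    exact ⟨C, delete_isCircuit_iff.2 ⟨hC, disjoint_left.2 fun x hx ↦ (hCss hx).2⟩, h⟩

/-- An element outside the closure of `F` in `M✶` is a nonloop of the contraction by `F`, hence lies
in a cocircuit there, and these cocircuits are the circuits of `M` avoiding `F`. -/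
theorem mem_sdiff_dual_closure_iff {F : Set α} :
    e ∈ M.E \ M✶.closure F ↔ ∃ C, M.IsCircuit C ∧ Disjoint C F ∧ e ∈ C := by
  rw [← dual_ground, ← contract_isNonloop_iff]
  refine ⟨fun h ↦ ?_, fun ⟨C, hC, hdj, heC⟩ ↦ ?_⟩
  · obtain ⟨C, hC, heC⟩ := h.exists_mem_isCocircuit
    rw [contract_isCocircuit_iff, dual_isCocircuit_iff] at hC
    exact ⟨C, hC.1, hC.2, heC⟩
  · exact IsCocircuit.isNonloop_of_mem
      (contract_isCocircuit_iff.2 ⟨dual_isCocircuit_iff.2 hC, hdj⟩) heC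

theorem not_isSkewPair_iff_isUnbreakable_dual [M.Finitary] (hM : M.IsConnected) :
    (∀ C₁ C₂, ¬ M.IsSkewPair C₁ C₂) ↔ M✶.IsUnbreakable := by
  refine ⟨fun h ↦ ⟨hM.dual, fun F hF ↦ ?_⟩, fun h C₁ C₂ hC ↦ ?_⟩
  · rw [isConnected_dual_contract_iff]
    intro e f he hf hef
    rw [← hF.closure, mem_sdiff_dual_closure_iff] at he hf
    obtain ⟨C₁, h₁, hd₁, he⟩ := he
    obtain ⟨C₂, h₂, hd₂, hf⟩ := hf
    obtain ⟨C, hCss, hC, heC, hfC⟩ :=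
      isConnectedSet_union_of_not_isSkewPair (h C₁ C₂) h₁ h₂ (Or.inl he) (Or.inr hf) hef
    exact ⟨C, subset_sdiff.2 ⟨hC.subset_ground, (disjoint_union_left.2 ⟨hd₁, hd₂⟩).mono_left hCss⟩,
      hC, heC, hfC⟩
  · have hss : C₁ ∪ C₂ ⊆ M.E := union_subset hC.left.subset_ground hC.right.subset_ground
    have hF : M✶.IsFlat (M.E \ (C₁ ∪ C₂)) := by
      rw [isFlat_iff_closure_eq]
      refine subset_antisymm (fun x hx ↦ ⟨M✶.closure_subset_ground _ hx, fun hxC ↦ ?_⟩)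
        (M✶.subset_closure _ sdiff_subset)
      refine (mem_sdiff_dual_closure_iff.2 ?_ : x ∈ M.E \ M✶.closure _).2 hx
      obtain hxC | hxC := hxC
      · exact ⟨C₁, hC.left, disjoint_sdiff_right.mono_left subset_union_left, hxC⟩
      · exact ⟨C₂, hC.right, disjoint_sdiff_right.mono_left subset_union_right, hxC⟩
    have hcon := h.2 _ hF
    rw [isConnected_dual_contract_iff, sdiff_sdiff_cancel_left hss] at hcon
    exact hC.not_isConnectedSet hcon

end Matroid

namespace Matroid

open Set

variable {α β : Type*} {M N : Matroid α} {C₁ C₂ D X Y : Set α} {e f g : α}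

/-! ### Isomorphism -/

theorem isCircuit_image_val_iff {I : Set M.E} :
    M.IsCircuit (Subtype.val '' I) ↔ ¬ M.Indep (Subtype.val '' I) ∧
      ∀ J, J ⊂ I → M.Indep (Subtype.val '' J) := by
  have hss : Subtype.val '' I ⊆ M.E := Subtype.coe_image_subset _ _
  rw [isCircuit_iff_forall_ssubset, ← not_indep_iff]
  refine and_congr_right fun _ ↦ ⟨fun h J hJ ↦ h ?_, fun h K hK ↦ ?_⟩
  · exact ⟨image_mono hJ.subset,
      fun hIJ ↦ hJ.not_subset ((image_subset_image_iff Subtype.val_injective).1 hIJ)⟩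
  · obtain ⟨J, hJ, rfl⟩ := subset_image_iff.1 hK.subset
    exact h J ⟨hJ, fun hIJ ↦ hK.not_subset (image_mono hIJ)⟩

theorem IsIsomorphic.exists_skewPair {N : Matroid β} (h : M.IsIsomorphic N) {C₁ C₂ : Set β}
    (hN : N.IsSkewPair C₁ C₂) : ∃ D₁ D₂, M.IsSkewPair D₁ D₂ := by
  obtain ⟨φ, hφ⟩ := h
  have hc : ∀ I : Set M.E, M.IsCircuit (Subtype.val '' I) ↔
      N.IsCircuit (Subtype.val '' (φ '' I)) := by
    intro I
    rw [isCircuit_image_val_iff, isCircuit_image_val_iff, hφ]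
    refine and_congr_right fun _ ↦ ⟨fun h J hJ ↦ ?_, fun h J hJ ↦ ?_⟩
    · obtain ⟨K, hK, rfl⟩ := subset_image_iff.1 hJ.subset
      exact (hφ K).1 (h K ⟨hK, fun hIK ↦ hJ.not_subset (image_mono hIK)⟩)
    · exact (hφ J).2 (h _ ⟨image_mono hJ.subset,
        fun hIJ ↦ hJ.not_subset ((image_subset_image_iff φ.injective).1 hIJ)⟩)
  have hex : ∀ C ⊆ N.E, ∃ I : Set M.E, C = Subtype.val '' (φ '' I) := by
    intro C hC
    refine ⟨φ ⁻¹' (Subtype.val ⁻¹' C), ?_⟩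
    rw [image_preimage_eq _ φ.surjective, Subtype.image_preimage_coe, inter_eq_right.2 hC]
  obtain ⟨I₁, rfl⟩ := hex C₁ hN.left.subset_ground
  obtain ⟨I₂, rfl⟩ := hex C₂ hN.right.subset_ground
  refine ⟨Subtype.val '' I₁, Subtype.val '' I₂, (hc _).2 hN.left, (hc _).2 hN.right, fun h ↦ ?_,
    fun D hD hss ↦ ?_⟩
  · exact hN.ne (by rw [Subtype.val_injective.image_injective h])
  · obtain ⟨J, rfl⟩ : ∃ J : Set M.E, D = Subtype.val '' J :=
      ⟨Subtype.val ⁻¹' D, by rw [Subtype.image_preimage_coe, inter_eq_right.2 hD.subset_ground]⟩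
    rw [← image_union, image_subset_image_iff Subtype.val_injective] at hss
    refine (hN.eq_or_eq ((hc J).1 hD) ?_).imp (fun h ↦ ?_) (fun h ↦ ?_)
    · rw [← image_union, ← image_union]
      exact image_mono (image_mono hss)
    · rw [φ.injective.image_injective (Subtype.val_injective.image_injective h)]
    · rw [φ.injective.image_injective (Subtype.val_injective.image_injective h)]

theorem isIsomorphic_of_bijOn {N : Matroid β} {u : α → β} (hu : BijOn u M.E N.E)
    (hc : ∀ C ⊆ M.E, M.IsCircuit C ↔ N.IsCircuit (u '' C)) : M.IsIsomorphic N := by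
  refine ⟨hu.equiv u, fun I ↦ ?_⟩
  have hI : Subtype.val '' I ⊆ M.E := Subtype.coe_image_subset _ _
  have himg : Subtype.val '' (hu.equiv u '' I) = u '' (Subtype.val '' I) := by
    rw [image_image, image_image]
    rfl
  rw [himg, indep_iff_forall_subset_not_isCircuit hI,
    indep_iff_forall_subset_not_isCircuit ((image_mono hI).trans hu.image_eq.subset)]
  refine ⟨fun h C hC ↦ ?_, fun h C hC hCc ↦ h _ (image_mono hC) ((hc C (hC.trans hI)).1 hCc)⟩
  obtain ⟨D, hD, rfl⟩ := subset_image_iff.1 hC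
  rw [← hc D (hD.trans hI)]
  exact h D hD

/-! ### Series minors -/

theorem delete_isSkewPair_iff :
    (M.delete X).IsSkewPair C₁ C₂ ↔ M.IsSkewPair C₁ C₂ ∧ Disjoint C₁ X ∧ Disjoint C₂ X := by
  refine ⟨fun h ↦ ?_, fun ⟨h, h₁, h₂⟩ ↦ ?_⟩
  · have h₁ := delete_isCircuit_iff.1 h.left
    have h₂ := delete_isCircuit_iff.1 h.right
    refine ⟨⟨h₁.1, h₂.1, h.ne, fun D hD hss ↦ h.eq_or_eq (delete_isCircuit_iff.2 ⟨hD, ?_⟩) hss⟩,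
      h₁.2, h₂.2⟩
    exact (disjoint_union_left.2 ⟨h₁.2, h₂.2⟩).mono_left hss
  · exact ⟨delete_isCircuit_iff.2 ⟨h.left, h₁⟩, delete_isCircuit_iff.2 ⟨h.right, h₂⟩, h.ne,
      fun D hD hss ↦ h.eq_or_eq hD.of_delete hss⟩

theorem IsCircuit.mem_iff_mem_of_isCocircuit (hD : M.IsCircuit D)
    (h : M.IsCocircuit {e, f}) : e ∈ D ↔ f ∈ D := by
  have key : ∀ {e f}, M.IsCocircuit {e, f} → e ∈ D → f ∈ D := by
    intro e f h he
    by_contra hf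
    refine hD.inter_isCocircuit_ne_singleton h (e := e) ?_
    ext x
    simp only [mem_inter_iff, mem_insert_iff, mem_singleton_iff]
    refine ⟨fun hx ↦ hx.2.resolve_right ?_, ?_⟩
    · rintro rfl
      exact hf hx.1
    · rintro rfl
      exact ⟨he, Or.inl rfl⟩
  exact ⟨key h, key (by rwa [pair_comm])⟩

/-- The circuits of a series contraction. -/
theorem contract_isCircuit_iff_of_isCocircuit (hef : e ≠ f) (h : M.IsCocircuit {e, f}) :
    (M.contract {e}).IsCircuit D ↔ ∃ C, M.IsCircuit C ∧ C \ {e} = D := by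
  have hex : ∀ D, (M.contract {e}).IsCircuit D → ∃ C, M.IsCircuit C ∧ C \ {e} = D := by
    intro D hD
    obtain ⟨C, hC, hDC, hCD⟩ := hD.exists_subset_isCircuit_of_contract
    refine ⟨C, hC, subset_antisymm (fun x hx ↦ (hCD hx.1).resolve_right hx.2) fun x hx ↦ ?_⟩
    exact ⟨hDC hx, (hD.subset_ground hx).2⟩
  refine ⟨hex D, ?_⟩
  rintro ⟨C, hC, rfl⟩
  have hiff := hC.mem_iff_mem_of_isCocircuit h
  by_cases he : e ∈ C
  · exact hC.contractElem_isCircuit ⟨e, he, f, hiff.1 he, hef⟩ he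
  · rw [sdiff_singleton_eq_self he]
    -- `C` might fail to be minimal in the contraction only through a circuit `K` using `e`; but
    -- then `f ∈ K - e ⊆ C`, which forces `e ∈ C`.
    obtain ⟨D, hDC, hD⟩ := (hC.contract_dep (disjoint_singleton_left.2 he)).exists_isCircuit_subset
    obtain ⟨K, hK, rfl⟩ := hex D hD
    have heK : e ∉ K := fun heK ↦ he (hiff.2 (hDC
      ⟨(hK.mem_iff_mem_of_isCocircuit h).1 heK, hef.symm⟩))
    rw [sdiff_singleton_eq_self heK] at hDC hD
    rwa [← hK.eq_of_subset_isCircuit hC hDC]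

theorem IsCircuit.subset_of_sdiff_subset (hD : M.IsCircuit D) (hef : e ≠ f)
    (h : M.IsCocircuit {e, f}) (hX : f ∈ X → e ∈ X) (hss : D \ {e} ⊆ X) : D ⊆ X := by
  intro x hx
  by_cases hxe : x = e
  · subst hxe
    exact hX (hss ⟨(hD.mem_iff_mem_of_isCocircuit h).1 hx, hef.symm⟩)
  · exact hss ⟨hx, hxe⟩

theorem IsCircuit.eq_of_sdiff_eq (h₁ : M.IsCircuit C₁) (h₂ : M.IsCircuit C₂) (hef : e ≠ f)
    (h : M.IsCocircuit {e, f}) (heq : C₁ \ {e} = C₂ \ {e}) : C₁ = C₂ :=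
  h₁.eq_of_subset_isCircuit h₂ (h₁.subset_of_sdiff_subset hef h
    (h₂.mem_iff_mem_of_isCocircuit h).2 (heq.trans_subset sdiff_subset))

/-- On circuits, `C ↦ C - e` is injective and reflects inclusion in unions of circuits, because `e`
can be recovered from its series partner `f`. -/
theorem contract_isSkewPair_iff (h₁ : M.IsCircuit C₁) (h₂ : M.IsCircuit C₂) (hef : e ≠ f)
    (h : M.IsCocircuit {e, f}) :
    (M.contract {e}).IsSkewPair (C₁ \ {e}) (C₂ \ {e}) ↔ M.IsSkewPair C₁ C₂ := by
  have hc := fun {D} ↦ contract_isCircuit_iff_of_isCocircuit (D := D) hef h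
  refine ⟨fun hs ↦ ⟨h₁, h₂, ?_, fun D hD hss ↦ ?_⟩, fun hs ↦ ⟨hc.2 ⟨_, h₁, rfl⟩,
    hc.2 ⟨_, h₂, rfl⟩, fun heq ↦ hs.ne (h₁.eq_of_sdiff_eq h₂ hef h heq), fun D hD hss ↦ ?_⟩⟩
  · rintro rfl
    exact hs.ne rfl
  · refine (hs.eq_or_eq (hc.2 ⟨D, hD, rfl⟩) ?_).imp (hD.eq_of_sdiff_eq h₁ hef h)
      (hD.eq_of_sdiff_eq h₂ hef h)
    rw [← union_sdiff_distrib]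
    exact sdiff_subset_sdiff_left hss
  · obtain ⟨K, hK, rfl⟩ := hc.1 hD
    rw [← union_sdiff_distrib] at hss
    have hK' := hK.subset_of_sdiff_subset hef h (X := C₁ ∪ C₂) (fun hf ↦ hf.imp
      (h₁.mem_iff_mem_of_isCocircuit h).2 (h₂.mem_iff_mem_of_isCocircuit h).2)
      (hss.trans sdiff_subset)
    refine (hs.eq_or_eq hK hK').imp (fun h ↦ by rw [h]) (fun h ↦ by rw [h])

theorem IsConnected.contract_of_isCocircuit (hM : M.IsConnected) (hef : e ≠ f)
    (h : M.IsCocircuit {e, f}) : (M.contract {e}).IsConnected := by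
  rintro x y ⟨hx, hxe⟩ ⟨hy, hye⟩ hxy
  obtain ⟨C, hC, hxC, hyC⟩ := hM hx hy hxy
  exact ⟨C \ {e}, (contract_isCircuit_iff_of_isCocircuit hef h).2 ⟨C, hC, rfl⟩, ⟨hxC, hxe⟩,
    ⟨hyC, hye⟩⟩

theorem IsSeriesMinor.trans {N₁ N₂ : Matroid α} (h : M.IsSeriesMinor N₁)
    (h' : N₁.IsSeriesMinor N₂) : M.IsSeriesMinor N₂ := by
  induction h' with
  | refl => exact h
  | delete e _ ih => exact ih.delete e
  | seriesContract e f hef hK _ ih => exact ih.seriesContract e f hef hK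

theorem IsSeriesMinor.finite [hM : M.Finite] (h : M.IsSeriesMinor N) : N.Finite := by
  induction h with
  | refl => exact hM
  | delete e _ ih => exact ⟨ih.ground_finite.subset sdiff_subset⟩
  | seriesContract e f hef hK _ ih => exact ⟨ih.ground_finite.subset sdiff_subset⟩

theorem isSeriesMinor_delete (M : Matroid α) (hX : X.Finite) : M.IsSeriesMinor (M.delete X) := by
  induction X, hX using Set.Finite.induction_on with
  | empty =>
    rw [delete_empty]
    exact .refl
  | @insert a X _ _ ih =>
    have h := ih.delete a
    rwa [delete_delete, union_singleton] at h

theorem IsSeriesMinor.exists_skewPair (h : M.IsSeriesMinor N) (hs : N.IsSkewPair C₁ C₂) :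
    ∃ D₁ D₂, M.IsSkewPair D₁ D₂ := by
  induction h generalizing C₁ C₂ with
  | refl => exact ⟨_, _, hs⟩
  | delete e _ ih => exact ih (delete_isSkewPair_iff.1 hs).1
  | seriesContract e f hef hK _ ih =>
    have hc := fun {D} ↦ contract_isCircuit_iff_of_isCocircuit (D := D) hef hK
    obtain ⟨D₁, h₁, rfl⟩ := hc.1 hs.left
    obtain ⟨D₂, h₂, rfl⟩ := hc.1 hs.right
    exact ih ((contract_isSkewPair_iff h₁ h₂ hef hK).1 hs)

/-! ### Series connections of uniform matroids -/

/-- Circuits have `r + 1` of the `r + 2` elements. -/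
theorem unif_isCircuit_iff {r : ℕ} {C : Set (Fin (r + 2))} :
    (unif r (r + 2)).IsCircuit C ↔ ∃ i, C = {i}ᶜ := by
  have hcard : ∀ i : Fin (r + 2), ({i}ᶜ : Set (Fin (r + 2))).ncard = r + 1 := by
    intro i
    rw [ncard_compl, ncard_singleton, Nat.card_fin]
    rfl
  have hcirc : ∀ i, (unif r (r + 2)).IsCircuit {i}ᶜ := by
    intro i
    rw [isCircuit_iff_forall_ssubset, ← not_indep_iff (subset_univ _), unif_indep_iff, hcard]
    refine ⟨by simp, fun I hI ↦ ?_⟩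
    have hlt := ncard_lt_ncard hI (toFinite _)
    rw [hcard] at hlt
    rw [unif_indep_iff]
    omega
  refine ⟨fun hC ↦ ?_, ?_⟩
  · obtain ⟨i, hi⟩ : ∃ i, i ∉ C := by
      by_contra! hcon
      have heq := (hcirc 0).eq_of_subset_isCircuit hC fun x _ ↦ hcon x
      have h0 := hcon 0
      rw [← heq] at h0
      exact h0 rfl
    exact ⟨i, hC.eq_of_subset_isCircuit (hcirc i) (subset_compl_singleton_iff.2 hi)⟩
  · rintro ⟨i, rfl⟩
    exact hcirc i

theorem seriesConnection_unif_isCircuit_iff {r s : ℕ} {p : Fin (r + 2)} {q : Fin (s + 2)}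
    {C : Set (Option (Fin (r + 2) ⊕ Fin (s + 2)))} :
    (seriesConnection (unif r (r + 2)) p (unif s (s + 2)) q).IsCircuit C ↔
      C = (fun x ↦ some (Sum.inl x)) '' {p}ᶜ ∨ C = (fun x ↦ some (Sum.inr x)) '' {q}ᶜ ∨
      ∃ i ≠ p, ∃ j ≠ q, C = insert none ((fun x ↦ some (Sum.inl x)) '' ({p}ᶜ \ {i}) ∪
        (fun x ↦ some (Sum.inr x)) '' ({q}ᶜ \ {j})) := by
  have hcomm : ∀ {n : ℕ} (i p : Fin n), ({i}ᶜ \ {p} : Set (Fin n)) = {p}ᶜ \ {i} := by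
    intro n i p
    ext x
    simp [and_comm]
  rw [seriesConnection_isCircuit_iff _ _ _ _ (mem_univ _) (mem_univ _)]
  constructor
  · rintro (⟨C₁, h, hp⟩ | ⟨C₂, h, hq⟩ | ⟨C₁, C₂, h₁, hp, h₂, hq⟩)
    · obtain ⟨i, rfl⟩ := unif_isCircuit_iff.1 h
      obtain rfl : p = i := by simpa using hp
      exact Or.inl rfl
    · obtain ⟨i, rfl⟩ := unif_isCircuit_iff.1 h
      obtain rfl : q = i := by simpa using hq
      exact Or.inr (Or.inl rfl)
    · obtain ⟨i, rfl⟩ := unif_isCircuit_iff.1 h₁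
      obtain ⟨j, rfl⟩ := unif_isCircuit_iff.1 h₂
      exact Or.inr (Or.inr ⟨i, Ne.symm hp, j, Ne.symm hq, by rw [hcomm i, hcomm j]⟩)
  · rintro (rfl | rfl | ⟨i, hi, j, hj, rfl⟩)
    · exact .left _ (unif_isCircuit_iff.2 ⟨p, rfl⟩) (by simp)
    · exact .right _ (unif_isCircuit_iff.2 ⟨q, rfl⟩) (by simp)
    · rw [← hcomm i, ← hcomm j]
      exact .through _ _ (unif_isCircuit_iff.2 ⟨i, rfl⟩) hi.symm (unif_isCircuit_iff.2 ⟨j, rfl⟩)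
        hj.symm

/-- Every other circuit contains the basepoint `none`, which neither of these does. -/
theorem seriesConnection_unif_isSkewPair {r s : ℕ} (p : Fin (r + 2)) (q : Fin (s + 2)) :
    (seriesConnection (unif r (r + 2)) p (unif s (s + 2)) q).IsSkewPair
      ((fun x ↦ some (Sum.inl x)) '' {p}ᶜ) ((fun x ↦ some (Sum.inr x)) '' {q}ᶜ) := by
  have h := (seriesConnection_unif_isCircuit_iff (p := p) (q := q)).2 (Or.inl rfl)
  refine ⟨h, seriesConnection_unif_isCircuit_iff.2 (Or.inr (Or.inl rfl)), fun heq ↦ ?_,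
    fun D hD hss ↦ ?_⟩
  · obtain ⟨x, hx⟩ := h.nonempty
    have hx' := heq.subset hx
    obtain ⟨y, -, rfl⟩ := hx
    simp at hx'
  · obtain rfl | rfl | ⟨i, -, j, -, rfl⟩ := seriesConnection_unif_isCircuit_iff.1 hD
    · exact Or.inl rfl
    · exact Or.inr rfl
    · simpa using hss (mem_insert _ _)

end Matroid

namespace Matroid

open Set

variable {α : Type*} {M N : Matroid α} {C₁ C₂ D K : Set α} {a b e f p x y : α}

/-! ### Minimal connected matroids with skew circuits -/

/-- No circuit through `f` avoids `e`, so `f` is in the coclosure of `e`. The circuit `D` ensures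
that `{f}` alone is not a cocircuit. -/
theorem isCocircuit_pair_of_forall_mem_iff (hef : e ≠ f) (hC : M.IsCircuit D) (hfD : f ∈ D)
    (h : ∀ C, M.IsCircuit C → (e ∈ C ↔ f ∈ C)) : M.IsCocircuit {e, f} := by
  have hcl : f ∈ M✶.closure {e} := by
    by_contra hcon
    obtain ⟨C, hC, hdj, hfC⟩ := mem_sdiff_dual_closure_iff.1 ⟨hC.subset_ground hfD, hcon⟩
    exact disjoint_left.1 hdj ((h C hC).2 hfC) rfl
  obtain ⟨K, hKss, hK, hfK⟩ := exists_isCircuit_of_mem_closure hcl hef.symm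
  have heK : e ∈ K := by
    by_contra heK
    refine hC.inter_isCocircuit_ne_singleton (isCocircuit_def.2 hK) (e := f) ?_
    refine subset_antisymm (fun x hx ↦ (hKss hx.2).resolve_right ?_)
      (singleton_subset_iff.2 ⟨hfD, hfK⟩)
    rintro rfl
    exact heK hx.2
  rw [isCocircuit_def]
  convert hK using 1
  rw [pair_comm]
  exact subset_antisymm (pair_subset hfK heK) hKss

/-- A connected matroid with a pair of skew circuits, minimal under deletion and series
contraction. -/
structure IsMinimalSkew (N : Matroid α) (C₁ C₂ : Set α) : Prop where
  skew : N.IsSkewPair C₁ C₂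
  connected : N.IsConnectedSet N.E
  -- All skew pairs are allowed here, not only `C₁`, `C₂`: `mem_of_disjoint` applies this to a new
  -- pair.
  eq_ground ⦃X D₁ D₂ : Set α⦄ : X ⊆ N.E → N.IsConnectedSet X → N.IsSkewPair D₁ D₂ →
    D₁ ∪ D₂ ⊆ X → X = N.E
  not_series ⦃e f : α⦄ : e ≠ f → ¬ N.IsCocircuit {e, f}

namespace IsMinimalSkew

theorem symm (h : N.IsMinimalSkew C₁ C₂) : N.IsMinimalSkew C₂ C₁ :=
  ⟨h.skew.symm, h.connected, h.eq_ground, h.not_series⟩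

theorem exists_isCircuit_mem_notMem (h : N.IsMinimalSkew C₁ C₂) (hx : x ∈ N.E) (hy : y ∈ N.E)
    (hxy : x ≠ y) : ∃ C, N.IsCircuit C ∧ (x ∈ C ∧ y ∉ C ∨ y ∈ C ∧ x ∉ C) := by
  by_contra! hcon
  obtain ⟨D, -, hD, -, hyD⟩ := h.connected hx hy hxy
  exact h.not_series hxy (isCocircuit_pair_of_forall_mem_iff hxy hD hyD
    fun C hC ↦ ⟨(hcon C hC).1, (hcon C hC).2⟩)

/-- The linking circuit makes the union connected, so minimality leaves nothing outside it. -/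
theorem eq_ground_of_inter_nonempty [N.Finitary] (h : N.IsMinimalSkew C₁ C₂) {D₁ D₂ : Set α}
    (hs : N.IsSkewPair D₁ D₂) (hD : N.IsCircuit D) (h₁ : (D ∩ D₁).Nonempty)
    (h₂ : (D ∩ D₂).Nonempty) : D₁ ∪ D ∪ D₂ = N.E := by
  refine h.eq_ground (union_subset (union_subset hs.left.subset_ground hD.subset_ground)
    hs.right.subset_ground) ?_ hs (union_subset_union_left _ subset_union_left)
  exact (hs.left.isConnectedSet.union hD.isConnectedSet (by rwa [inter_comm])).union
    hs.right.isConnectedSet (h₂.mono (inter_subset_inter_left _ subset_union_right))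

theorem exists_isCircuit_inter_nonempty (h : N.IsMinimalSkew C₁ C₂) :
    ∃ D, N.IsCircuit D ∧ (D ∩ C₁).Nonempty ∧ (D ∩ C₂).Nonempty := by
  obtain ⟨x₁, hx₁⟩ := h.skew.left.nonempty
  obtain ⟨x₂, hx₂⟩ := h.skew.right.nonempty
  obtain ⟨D, -, hD, h₁, h₂⟩ := h.connected (h.skew.left.subset_ground hx₁)
    (h.skew.right.subset_ground hx₂) (fun heq ↦ disjoint_left.1 h.skew.disjoint hx₁ (heq ▸ hx₂))
  exact ⟨D, hD, ⟨_, h₁, hx₁⟩, ⟨_, h₂, hx₂⟩⟩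

/-- If `D` missed `y`, then `D` and `C₂` would be a skew pair as well. A circuit `K` linking `C₁` to
`C₂` also links this new pair, so minimality puts `C₁ \ D` into `K`. Varying `D` puts all of `C₁`
into `K`, which is impossible. -/
theorem mem_of_disjoint [N.Finitary] (h : N.IsMinimalSkew C₁ C₂) (hD : N.IsCircuit D)
    (hdj : Disjoint D C₂) (hx : x ∈ D) (hxC : x ∉ C₁ ∪ C₂) (hy : y ∈ N.E) (hyC : y ∉ C₁ ∪ C₂) :
    y ∈ D := by
  by_contra hyD
  obtain ⟨K, hK, hK₁, hK₂⟩ := h.exists_isCircuit_inter_nonempty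
  have hKE := h.eq_ground_of_inter_nonempty h.skew hK hK₁ hK₂
  have hSK : ∀ z ∈ N.E, z ∉ C₁ ∪ C₂ → z ∈ K := by
    intro z hz hzC
    rw [← hKE] at hz
    simp only [mem_union] at hz hzC
    tauto
  have key : ∀ D, N.IsCircuit D → Disjoint D C₂ → x ∈ D → y ∉ D → C₁ \ D ⊆ K := by
    intro D hD hdj hx hyD c hc
    have hm : (C₁ ∩ D).Nonempty := by
      by_contra hm
      have hDK : D ⊆ K := fun z hz ↦ hSK z (hD.subset_ground hz) fun hzC ↦
        hzC.elim (fun h ↦ hm ⟨z, h, hz⟩) (disjoint_left.1 hdj hz)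
      exact hyD (hD.eq_of_subset_isCircuit hK hDK ▸ hSK y hy hyC)
    have hs : N.IsSkewPair D C₂ := by
      refine ⟨hD, h.skew.right, fun heq ↦ hxC (Or.inr (heq ▸ hx)), fun G hG hss ↦ ?_⟩
      by_contra! hcon
      obtain ⟨hGD, hGC⟩ := hD.exists_inter_nonempty h.skew.right hG hss hcon.1 hcon.2
      -- A third circuit `G` in `D ∪ C₂` would link `C₁`, `D` and `C₂` into a connected set that
      -- misses `y`.
      have hconn := ((h.skew.left.isConnectedSet.union hD.isConnectedSet hm).union hG.isConnectedSet
        (hGD.mono fun z hz ↦ ⟨Or.inr hz.2, hz.1⟩)).union h.skew.right.isConnectedSet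
        (hGC.mono fun z hz ↦ ⟨Or.inr hz.1, hz.2⟩)
      have heq := h.eq_ground (union_subset (union_subset (union_subset h.skew.left.subset_ground
        hD.subset_ground) hG.subset_ground) h.skew.right.subset_ground) hconn h.skew
        (fun z hz ↦ hz.elim (fun h ↦ Or.inl (Or.inl (Or.inl h))) Or.inr)
      rw [← heq] at hy
      have := @hss y
      simp only [mem_union] at hy hyC this
      tauto
    have hE := h.eq_ground_of_inter_nonempty hs hK ⟨x, hSK x (hD.subset_ground hx) hxC, hx⟩ hK₂
    have hcE := h.skew.left.subset_ground hc.1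
    rw [← hE] at hcE
    exact (hcE.resolve_right (disjoint_left.1 h.skew.disjoint hc.1)).resolve_left hc.2
  have hCK : C₁ ⊆ K := by
    intro c hc
    by_cases hcD : c ∈ D
    · obtain ⟨G, hGss, hG, hxG⟩ := hD.strong_elimination h.skew.left hcD hc hx (hxC ∘ Or.inl)
      refine key G hG ?_ hxG (fun hyG ↦ ?_) ⟨hc, fun hcG ↦ (hGss hcG).2 rfl⟩
      · exact (disjoint_union_left.2 ⟨hdj, h.skew.disjoint⟩).mono_left (hGss.trans sdiff_subset)
      · exact (hGss hyG).1.elim hyD (hyC ∘ Or.inl)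
    · exact key D hD hdj hx hyD ⟨hc, hcD⟩
  rw [← h.skew.left.eq_of_subset_isCircuit hK hCK] at hK₂
  exact hK₂.ne_empty h.skew.disjoint.inter_eq

theorem mem_of_mem [N.Finitary] (h : N.IsMinimalSkew C₁ C₂) (hD : N.IsCircuit D) (hx : x ∈ D)
    (hxC : x ∉ C₁ ∪ C₂) (hy : y ∈ N.E) (hyC : y ∉ C₁ ∪ C₂) : y ∈ D := by
  by_cases h₂ : (D ∩ C₂).Nonempty
  · by_cases h₁ : (D ∩ C₁).Nonempty
    · rw [← h.eq_ground_of_inter_nonempty h.skew hD h₁ h₂] at hy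
      simp only [mem_union] at hy hyC
      tauto
    · rw [not_nonempty_iff_eq_empty, ← disjoint_iff_inter_eq_empty] at h₁
      rw [union_comm] at hxC hyC
      exact h.symm.mem_of_disjoint hD h₁ hx hxC hy hyC
  · rw [not_nonempty_iff_eq_empty, ← disjoint_iff_inter_eq_empty] at h₂
    exact h.mem_of_disjoint hD h₂ hx hxC hy hyC

theorem exists_ground_eq [N.Finitary] (h : N.IsMinimalSkew C₁ C₂) :
    ∃ p ∉ C₁ ∪ C₂, N.E = insert p (C₁ ∪ C₂) := by
  obtain ⟨D, hD, h₁, h₂⟩ := h.exists_isCircuit_inter_nonempty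
  obtain ⟨p, hpD, hp⟩ : ∃ p ∈ D, p ∉ C₁ ∪ C₂ := by
    by_contra! hcon
    obtain rfl | rfl := h.skew.eq_or_eq hD hcon
    · exact h₂.ne_empty h.skew.disjoint.inter_eq
    · exact h₁.ne_empty h.skew.disjoint.symm.inter_eq
  have hpE := hD.subset_ground hpD
  refine ⟨p, hp, subset_antisymm (fun x hx ↦ ?_) (insert_subset hpE
    (union_subset h.skew.left.subset_ground h.skew.right.subset_ground))⟩
  by_contra hxC
  rw [mem_insert_iff, not_or] at hxC
  obtain ⟨C, hC, ⟨hxC', hpC⟩ | ⟨hpC, hxC'⟩⟩ := h.exists_isCircuit_mem_notMem hx hpE hxC.1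
  · exact hpC (h.mem_of_mem hC hxC' hxC.2 hpE hp)
  · exact hxC' (h.mem_of_mem hC hpC hp hx hxC.2)

/-- Otherwise some circuit separates `a` from `b`. It must use `p`, and eliminating `p` against `D`
gives a circuit inside `C₁ ∪ C₂` containing just one of them, so neither `C₁` nor `C₂`. -/
theorem eq_of_notMem (h : N.IsMinimalSkew C₁ C₂) (hE : N.E = insert p (C₁ ∪ C₂))
    (hD : N.IsCircuit D) (hpD : p ∈ D) (ha : a ∈ C₁) (hb : b ∈ C₁) (haD : a ∉ D) (hbD : b ∉ D) :
    a = b := by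
  have key : ∀ {a b}, a ∈ C₁ → b ∈ C₁ → a ∉ D → b ∉ D → ∀ C, N.IsCircuit C → a ∈ C → b ∈ C := by
    intro a b ha hb haD hbD C hC haC
    by_contra hbC
    have hne : ∀ K, N.IsCircuit K → a ∈ K → b ∉ K → p ∉ K → False := by
      intro K hK haK hbK hpK
      have hKE := hK.subset_ground
      rw [hE, subset_insert_iff_of_notMem hpK] at hKE
      obtain rfl | rfl := h.skew.eq_or_eq hK hKE
      · exact hbK hb
      · exact disjoint_left.1 h.skew.disjoint ha haK
    have hpC : p ∈ C := by
      by_contra hpC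
      exact hne C hC haC hbC hpC
    obtain ⟨K, hKss, hK, haK⟩ := hC.strong_elimination hD hpC hpD haC haD
    exact hne K hK haK (fun hbK ↦ (hKss hbK).1.elim hbC hbD) (fun hpK ↦ (hKss hpK).2 rfl)
  by_contra hab
  obtain ⟨C, hC, ⟨haC, hbC⟩ | ⟨hbC, haC⟩⟩ := h.exists_isCircuit_mem_notMem
    (h.skew.left.subset_ground ha) (h.skew.left.subset_ground hb) hab
  · exact hbC (key ha hb haD hbD C hC haC)
  · exact haC (key hb ha hbD haD C hC hbC)

theorem exists_inter_eq (h : N.IsMinimalSkew C₁ C₂) (hp : p ∉ C₁ ∪ C₂)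
    (hE : N.E = insert p (C₁ ∪ C₂)) (hD : N.IsCircuit D) (hpD : p ∈ D) :
    ∃ a ∈ C₁, D ∩ C₁ = C₁ \ {a} := by
  obtain ⟨a, ha, haD⟩ : ∃ a ∈ C₁, a ∉ D := by
    by_contra! hcon
    exact hp (Or.inl (h.skew.left.eq_of_subset_isCircuit hD hcon ▸ hpD))
  refine ⟨a, ha, subset_antisymm (fun x hx ↦ ⟨hx.2, ?_⟩) fun x hx ↦ ⟨?_, hx.1⟩⟩
  · by_contra hxD
    exact hx.2 (h.eq_of_notMem hE hD hpD hx.1 ha hxD haD)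
  · rintro rfl
    exact haD hx.1

theorem exists_eq (h : N.IsMinimalSkew C₁ C₂) (hp : p ∉ C₁ ∪ C₂) (hE : N.E = insert p (C₁ ∪ C₂))
    (hD : N.IsCircuit D) (hpD : p ∈ D) :
    ∃ a ∈ C₁, ∃ b ∈ C₂, D = insert p (C₁ \ {a} ∪ C₂ \ {b}) := by
  obtain ⟨a, ha, haD⟩ := h.exists_inter_eq hp hE hD hpD
  rw [union_comm] at hp
  obtain ⟨b, hb, hbD⟩ := h.symm.exists_inter_eq hp (by rwa [union_comm]) hD hpD
  refine ⟨a, ha, b, hb, ?_⟩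
  rw [← haD, ← hbD, ← inter_union_distrib_left, ← inter_insert_of_mem hpD, ← hE,
    inter_eq_left.2 hD.subset_ground]

/-- Eliminate `a'` against `C₁` while keeping `p`: the result misses `a'` and `b`, and `exists_eq`
leaves one possibility. -/
theorem isCircuit_of_isCircuit (h : N.IsMinimalSkew C₁ C₂) (hp : p ∉ C₁ ∪ C₂)
    (hE : N.E = insert p (C₁ ∪ C₂)) {a' : α} (ha : a ∈ C₁) (hb : b ∈ C₂) (ha' : a' ∈ C₁)
    (hD : N.IsCircuit (insert p (C₁ \ {a} ∪ C₂ \ {b}))) :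
    N.IsCircuit (insert p (C₁ \ {a'} ∪ C₂ \ {b})) := by
  obtain rfl | hne := eq_or_ne a' a
  · exact hD
  have hdj := disjoint_left.1 h.skew.disjoint
  obtain ⟨K, hKss, hK, hpK⟩ := hD.strong_elimination h.skew.left (e := a') (f := p)
    (Or.inr (Or.inl ⟨ha', hne⟩)) ha' (mem_insert _ _) (hp ∘ Or.inl)
  have haK : a' ∉ K := fun h ↦ (hKss h).2 rfl
  have hbp : b ≠ p := by
    rintro rfl
    exact hp (Or.inr hb)
  have hbK : b ∉ K := by
    intro hbK
    have := (hKss hbK).1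
    have hb₁ : b ∉ C₁ := fun h ↦ hdj h hb
    simp [hbp, hb₁] at this
  obtain ⟨c, hc, d, hd, rfl⟩ := h.exists_eq hp hE hK hpK
  obtain rfl : a' = c := by
    by_contra hne
    exact haK (Or.inr (Or.inl ⟨ha', hne⟩))
  obtain rfl : b = d := by
    by_contra hne
    exact hbK (Or.inr (Or.inr ⟨hb, hne⟩))
  exact hK

theorem isCircuit (h : N.IsMinimalSkew C₁ C₂) (hp : p ∉ C₁ ∪ C₂)
    (hE : N.E = insert p (C₁ ∪ C₂)) (hD : N.IsCircuit D) (hpD : p ∈ D) (ha : a ∈ C₁) (hb : b ∈ C₂) :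
    N.IsCircuit (insert p (C₁ \ {a} ∪ C₂ \ {b})) := by
  obtain ⟨a', ha', b', hb', rfl⟩ := h.exists_eq hp hE hD hpD
  have h₁ := h.isCircuit_of_isCircuit hp hE ha' hb' ha hD
  rw [union_comm] at h₁ hp ⊢
  exact h.symm.isCircuit_of_isCircuit hp (by rwa [union_comm]) hb' ha hb h₁

theorem isCircuit_iff [N.Finitary] (h : N.IsMinimalSkew C₁ C₂) (hp : p ∉ C₁ ∪ C₂)
    (hE : N.E = insert p (C₁ ∪ C₂)) : N.IsCircuit D ↔
      D = C₁ ∨ D = C₂ ∨ ∃ a ∈ C₁, ∃ b ∈ C₂, D = insert p (C₁ \ {a} ∪ C₂ \ {b}) := by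
  have hmem : ∀ {D}, N.IsCircuit D → p ∈ D ∨ D = C₁ ∨ D = C₂ := by
    intro D hD
    by_cases hpD : p ∈ D
    · exact Or.inl hpD
    · have hss := hD.subset_ground
      rw [hE, subset_insert_iff_of_notMem hpD] at hss
      exact Or.inr (h.skew.eq_or_eq hD hss)
  refine ⟨fun hD ↦ ?_, ?_⟩
  · obtain hpD | rfl | rfl := hmem hD
    · exact Or.inr (Or.inr (h.exists_eq hp hE hD hpD))
    · exact Or.inl rfl
    · exact Or.inr (Or.inl rfl)
  · rintro (rfl | rfl | ⟨a, ha, b, hb, rfl⟩)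
    · exact h.skew.left
    · exact h.skew.right
    · obtain ⟨K, hK, h₁, h₂⟩ := h.exists_isCircuit_inter_nonempty
      obtain hpK | rfl | rfl := hmem hK
      · exact h.isCircuit hp hE hK hpK ha hb
      · exact absurd h.skew.disjoint.inter_eq h₂.ne_empty
      · exact absurd h.skew.disjoint.symm.inter_eq h₁.ne_empty

/-- A singleton `C₁` would be contained in the circuit linking it to `C₂`. This bound is the source
of `k, l > 2`. -/
theorem one_lt_ncard [N.Finite] (h : N.IsMinimalSkew C₁ C₂) : 1 < C₁.ncard := by
  rw [one_lt_ncard_iff_nontrivial_and_finite]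
  refine ⟨?_, h.skew.left.finite⟩
  by_contra hnt
  obtain ⟨a, ha⟩ := h.skew.left.nonempty
  rw [not_nontrivial_iff] at hnt
  obtain ⟨D, hD, ⟨x, hxD, hx₁⟩, h₂⟩ := h.exists_isCircuit_inter_nonempty
  have hss : C₁ ⊆ D := fun y hy ↦ hnt hx₁ hy ▸ hxD
  rw [← h.skew.left.eq_of_subset_isCircuit hD hss] at h₂
  exact h₂.ne_empty h.skew.disjoint.inter_eq

theorem isIsomorphic [N.Finite] (h : N.IsMinimalSkew C₁ C₂) : ∃ r s, 0 < r ∧ 0 < s ∧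
    N.IsIsomorphic (seriesConnection (unif r (r + 2)) 0 (unif s (s + 2)) 0) := by
  classical
  obtain ⟨p, hp, hE⟩ := h.exists_ground_eq
  have hp₁ : p ∉ C₁ := hp ∘ Or.inl
  have hp₂ : p ∉ C₂ := hp ∘ Or.inr
  have hdj := disjoint_right.1 h.skew.disjoint
  have hex : ∀ C : Set α, C.Finite → 1 < C.ncard →
      ∃ r, 0 < r ∧ ∃ u : α → Fin (r + 2), BijOn u C {0}ᶜ := by
    intro C hC h1
    -- Removing the basepoint `0` from `Fin (r + 2)` leaves `r + 1` elements, to be matched with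
    -- `C`.
    refine ⟨C.ncard - 1, by omega, hC.exists_bijOn_of_encard_eq ?_⟩
    rw [← hC.cast_ncard_eq, ← (toFinite _).cast_ncard_eq, ncard_compl, ncard_singleton,
      Nat.card_fin]
    congr 1
    omega
  obtain ⟨r, hr, u, hu⟩ := hex C₁ h.skew.left.finite h.one_lt_ncard
  obtain ⟨s, hs, v, hv⟩ := hex C₂ h.skew.right.finite h.symm.one_lt_ncard
  refine ⟨r, s, hr, hs, ?_⟩
  let w : α → Option (Fin (r + 2) ⊕ Fin (s + 2)) := fun x ↦
    if x ∈ C₁ then some (Sum.inl (u x)) else if x ∈ C₂ then some (Sum.inr (v x)) else none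
  have hw₁ : ∀ x ∈ C₁, w x = some (Sum.inl (u x)) := fun x hx ↦ by simp [w, hx]
  have hw₂ : ∀ x ∈ C₂, w x = some (Sum.inr (v x)) := fun x hx ↦ by simp [w, hx, hdj hx]
  have hwp : w p = none := by simp [w, hp₁, hp₂]
  have him₁ : w '' C₁ = (fun x ↦ some (Sum.inl x)) '' {0}ᶜ := by
    rw [← hu.image_eq, image_image]
    exact image_congr hw₁
  have him₂ : w '' C₂ = (fun x ↦ some (Sum.inr x)) '' {0}ᶜ := by
    rw [← hv.image_eq, image_image]
    exact image_congr hw₂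
  have hinj : InjOn w N.E := by
    rw [hE]
    rintro x (rfl | hx | hx) y (rfl | hy | hy) hxy
    · rfl
    · simp [hwp, hw₁ y hy] at hxy
    · simp [hwp, hw₂ y hy] at hxy
    · simp [hwp, hw₁ x hx] at hxy
    · rw [hw₁ x hx, hw₁ y hy] at hxy
      exact hu.injOn hx hy (by simpa using hxy)
    · simp [hw₁ x hx, hw₂ y hy] at hxy
    · simp [hwp, hw₂ x hx] at hxy
    · simp [hw₂ x hx, hw₁ y hy] at hxy
    · rw [hw₂ x hx, hw₂ y hy] at hxy
      exact hv.injOn hx hy (by simpa using hxy)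
  have him : ∀ a ∈ C₁, ∀ b ∈ C₂, w '' insert p (C₁ \ {a} ∪ C₂ \ {b}) =
      insert none ((fun x ↦ some (Sum.inl x)) '' ({0}ᶜ \ {u a}) ∪
        (fun x ↦ some (Sum.inr x)) '' ({0}ᶜ \ {v b})) := by
    intro a ha b hb
    rw [image_insert_eq, image_union, hwp,
      (hinj.mono h.skew.left.subset_ground).image_sdiff_subset (singleton_subset_iff.2 ha),
      (hinj.mono h.skew.right.subset_ground).image_sdiff_subset (singleton_subset_iff.2 hb),
      him₁, him₂, image_singleton, image_singleton, hw₁ a ha, hw₂ b hb,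
      image_sdiff (fun x y h ↦ by simpa using h), image_sdiff (fun x y h ↦ by simpa using h),
      image_singleton, image_singleton]
  have himE : w '' N.E = (seriesConnection (unif r (r + 2)) 0 (unif s (s + 2)) 0).E := by
    rw [hE, image_insert_eq, image_union, him₁, him₂, hwp, seriesConnection_ground, unif_ground,
      unif_ground, ← compl_eq_univ_sdiff, ← compl_eq_univ_sdiff]
  refine isIsomorphic_of_bijOn (u := w) (himE ▸ hinj.bijOn_image) fun C hC ↦ ?_
  · rw [h.isCircuit_iff hp hE, seriesConnection_unif_isCircuit_iff, ← him₁, ← him₂,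
      hinj.image_eq_image_iff hC h.skew.left.subset_ground,
      hinj.image_eq_image_iff hC h.skew.right.subset_ground]
    refine or_congr_right (or_congr_right ⟨?_, ?_⟩)
    · rintro ⟨a, ha, b, hb, rfl⟩
      exact ⟨u a, hu.mapsTo ha, v b, hv.mapsTo hb, him a ha b hb⟩
    · rintro ⟨i, hi, j, hj, hij⟩
      obtain ⟨a, ha, rfl⟩ := hu.surjOn hi
      obtain ⟨b, hb, rfl⟩ := hv.surjOn hj
      refine ⟨a, ha, b, hb, ?_⟩
      rw [← him a ha b hb] at hij
      refine (hinj.image_eq_image_iff hC ?_).1 hij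
      rw [hE]
      exact insert_subset_insert (union_subset_union sdiff_subset sdiff_subset)

end IsMinimalSkew

/-- A connected matroid with skew circuits has a minimal such series minor. -/
theorem exists_isSeriesMinor_isMinimalSkew [M.Finite] (hM : M.IsConnected)
    (hs : M.IsSkewPair C₁ C₂) :
    ∃ N D₁ D₂, M.IsSeriesMinor N ∧ N.IsMinimalSkew D₁ D₂ := by
  induction hn : M.E.ncard using Nat.strong_induction_on generalizing M C₁ C₂ with
  | _ n ih =>
  subst hn
  by_contra! hcon
  -- By induction no smaller connected series minor has a skew pair, so `M` itself must be minimal.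
  have key : ∀ N D₁ D₂, M.IsSeriesMinor N → N.IsConnected → N.IsSkewPair D₁ D₂ →
      ¬ N.E ⊂ M.E := by
    intro N D₁ D₂ hN hNc hNs hss
    have := hN.finite
    obtain ⟨K, K₁, K₂, hK, hKm⟩ := ih _ (ncard_lt_ncard hss M.ground_finite) hNc hNs rfl
    exact hcon K K₁ K₂ (hN.trans hK) hKm
  refine hcon M C₁ C₂ .refl ⟨hs, isConnected_iff_isConnectedSet_ground.1 hM,
    fun X D₁ D₂ hX hXc hD hDX ↦ ?_, fun e f hef hK ↦ ?_⟩
  · by_contra hne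
    have hdj : Disjoint X (M.E \ X) := disjoint_sdiff_right
    have hE : (M.delete (M.E \ X)).E = X := by rw [delete_ground, sdiff_sdiff_cancel_left hX]
    refine key (M.delete (M.E \ X)) D₁ D₂ (M.isSeriesMinor_delete
      (M.ground_finite.subset sdiff_subset)) ?_ (delete_isSkewPair_iff.2 ⟨hD,
      hdj.mono_left (subset_union_left.trans hDX), hdj.mono_left (subset_union_right.trans hDX)⟩)
      (hE.trans_ssubset (hX.ssubset_of_ne hne))
    intro x y hx hy hxy
    rw [hE] at hx hy
    obtain ⟨C, hCX, hC, h⟩ := hXc hx hy hxy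
    exact ⟨C, delete_isCircuit_iff.2 ⟨hC, hdj.mono_left hCX⟩, h⟩
  · refine key (M.contract {e}) _ _ (.seriesContract e f hef hK .refl)
      (hM.contract_of_isCocircuit hef hK)
      ((contract_isSkewPair_iff hs.left hs.right hef hK).2 hs) ⟨sdiff_subset, fun hss ↦ ?_⟩
    exact (hss (hK.subset_ground (mem_insert e {f}))).2 rfl

end Matroid

theorem theorem1p1 {α : Type*} (M : Matroid α) [M.Finite] (hM : M.IsConnected) :
    List.TFAE [
      M.HasSSCE,
      ¬ M.HasSkewCircuits,
      ∀ k l : ℕ, 2 < k → 2 < l → ∀ (p : Fin k) (q : Fin l) (N : Matroid α), M.IsSeriesMinor N →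
        ¬ N.IsIsomorphic
          (Matroid.seriesConnection (Matroid.unif (k - 2) k) p (Matroid.unif (l - 2) l) q),
      M✶.IsUnbreakable] := by
  have hiff : ¬ M.HasSkewCircuits ↔ ∀ C₁ C₂, ¬ M.IsSkewPair C₁ C₂ := by
    rw [Matroid.hasSkewCircuits_iff]
    push Not
    rfl
  rw [hiff]
  tfae_have 1 → 2 := fun h _ _ ↦ h.not_isSkewPair hM
  tfae_have 2 → 1 := Matroid.hasSSCE_of_not_isSkewPair
  tfae_have 2 ↔ 4 := Matroid.not_isSkewPair_iff_isUnbreakable_dual hM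
  tfae_have 2 → 3 := by
    intro h k l hk hl p q N hN hiso
    obtain ⟨r, rfl⟩ := Nat.exists_eq_add_of_le' hk.le
    obtain ⟨s, rfl⟩ := Nat.exists_eq_add_of_le' hl.le
    obtain ⟨_, _, hs⟩ := hiso.exists_skewPair (Matroid.seriesConnection_unif_isSkewPair p q)
    obtain ⟨_, _, hs⟩ := hN.exists_skewPair hs
    exact h _ _ hs
  tfae_have 3 → 2 := by
    intro h C₁ C₂ hs
    obtain ⟨N, D₁, D₂, hN, hmin⟩ := Matroid.exists_isSeriesMinor_isMinimalSkew hM hs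
    have := hN.finite
    obtain ⟨r, s, hr, hs, hiso⟩ := hmin.isIsomorphic
    exact h (r + 2) (s + 2) (by omega) (by omega) 0 0 N hN hiso
  tfae_finish
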